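/- **Setting.** Let $p_0=1$, and let $p_i>0$, $q_i=1-p_i>0$ for $i\ge 1$ ($q_0=0$). Let $(X_k)_{k\ge0}$ be the Markov chain on $\{0,1,2,\dots\}$ that moves from $i$ to $i+1$ with probability $p_i$ and from $i$ to $i-1$ with probability $q_i$. For each state $i$ let $\tau_{i}^{+},\tau_i^-$ be positive random variables (waiting times before a jump to the right or to the left), with independent copies $\tau_{i,k}^\pm$, $k\ge 0$, all independent of each other and of the chain. Put $T_0=0$, $T_{k+1}=T_k+\tau^k$, where $\tau^k=\tau^{+}_{i,k}$ if $X_k=i$, $X_{k+1}=i+1$ and $\tau^k=\tau^-_{i,k}$ if $X_k=i$, $X_{k+1}=i-1$; the continuous-time random walk is $X(t)=X_k$ for $t\in[T_k,T_{k+1})$. Let $\sigma_n=\inf\{t\ge0: X(t)=n\}$ (with $\inf\emptyset=\infty$). The walk *explodes* if $\lim_{n\to\infty}\sigma_n<\infty$. It *implodes* from infinity if $\lim_{C\to\infty}\sup_i \mathsf P_i(\sigma_0>C)=0$, where $\mathsf P_i$ is the probability given $X(0)=i$. Put $\delta_k=\frac{q_1\cdots q_k}{p_1\cdots p_k}$ and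 $\nu_i=(1-p_i\mathsf E e^{-\tau_i^+}-q_i\mathsf E e^{-\tau_i^-})\frac{p_1\cdots p_{i-1}}{q_1\cdots q_i}$ (empty products are $1$). The *general conditions* are $$\text{(E)}\ \sum_{k\ge0}\Big(\sum_{i\le k}\nu_i\Big)\delta_k<\infty,\qquad \text{(I)}\ \sum_{k\ge0}\Big(\sum_{i>k}\nu_i\Big)\delta_k<\infty\ \text{ and }\ \sum_{k\ge0}\delta_k=\infty .$$ For positive weights $b=(b_i)_{i\ge0}$ consider the conditions $$\text{(E$_b$)}\ \sum_{i\ge0} b_i\sum_{k\ge i}\frac{q_{i+1}\cdots q_k}{p_i\cdots p_k}<\infty,\qquad \text{(I$_b$)}\ \sum_{i\ge1} b_i\sum_{k=0}^{i-1}\frac{p_{k+1}\cdots p_{i-1}}{q_{k+1}\cdots q_i}<\infty\ \text{ and }\ \sum_{k\ge0}\delta_k=\infty .$$ **Theorem.** Let $a_i>0$, $i\ge0$. In each of the three cases 1. (Markov) $\tau_i^+$ and $\tau_i^-$ are exponential with rate $a_i$; $b_i=1/a_i$; 2. (finite means) $\tau_i^\pm\overset{d}{=}\tau^\pm/a_i$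 with $\tau^\pm>0$ and $\mathsf E\tau^+=\mathsf E\tau^-<\infty$; $b_i=1/a_i$; 3. ($\alpha$-stable) $\tau_i^\pm\overset{d}{=}\tau/a_i$, where $\tau>0$ is strictly $\alpha$-stable with $0<\alpha<1$ (that is, for every $n\ge1$ the sum of $n$ independent copies of $\tau$ has the law of $n^{1/\alpha}\tau$); $b_i=a_i^{-\alpha}$; the following hold. * (E) holds if and only if (E$_b$) holds, and (I) holds if and only if (I$_b$) holds. * For every initial distribution, the walk explodes with probability $1$ if and only if (E$_b$) holds, and explodes with probability $0$ if and only if (E$_b$) fails. * The walk implodes from infinity if and only if (I$_b$) holds; and $\lim_{C\to\infty}\sup_i\mathsf P_i(\sigma_0>C)=1$ if and only if (I$_b$) fails. * If $p_i=p$ and $q_i=q=1-p$ for all $i\ge1$, then (E$_b$) holds if and only if $\sum_i b_i<\infty$ and $p>q$; and (I$_b$) holds if and only if either $\sum_i b_i<\infty$ and $p<q$, or $\sum_i i\,b_i<\infty$ and $p=q$. -/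

import Mathlib

open MeasureTheory ProbabilityTheory Filter Topology
open scoped NNReal ENNReal

universe u

noncomputable section

/-- Directions of the jumps of a birth-and-death walk. -/
inductive Dir where
  | right : Dir
  | left : Dir

/-- Transition probabilities of the birth-and-death chain on `{0,1,2,…}`: up with probability
`p i`, down with probability `q i = 1 - p i`. -/
def bdTrans (p : ℕ → ℝ) (i j : ℕ) : ℝ :=
  if j = i + 1 then p i else if i = j + 1 then 1 - p i else 0

/-- Admissible transition probabilities: `p 0 = 1`, and `p i`, `q i = 1 - p i` are positive
for `i ≥ 1`. -/
def IsBirthDeath (p : ℕ → ℝ) : Prop :=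
  p 0 = 1 ∧ ∀ i, 1 ≤ i → 0 < p i ∧ 0 < 1 - p i

/-- The ingredients of a continuous-time random walk, under the probability measure `μ` : a
birth-and-death Markov chain `X` (with any initial distribution), and waiting times `τ d i k`
(the `k`-th copy of the waiting time at state `i` before a jump in direction `d`) with law
`F d i`, all independent of each other and of the chain. -/
structure IsCTRW {Ω : Type*} [MeasurableSpace Ω] (p : ℕ → ℝ) (F : Dir → ℕ → Measure ℝ)
    (X : ℕ → Ω → ℕ) (τ : Dir → ℕ → ℕ → Ω → ℝ) (μ : Measure Ω) : Prop where
  isProbabilityMeasure : IsProbabilityMeasure μ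
  measurable_chain : ∀ k, Measurable (X k)
  measurable_wait : ∀ d i k, Measurable (τ d i k)
  markov : ∀ (n : ℕ) (x : ℕ → ℕ),
    μ {ω | ∀ k ≤ n + 1, X k ω = x k} =
      μ {ω | ∀ k ≤ n, X k ω = x k} * ENNReal.ofReal (bdTrans p (x n) (x (n + 1)))
  law_wait : ∀ d i k, μ.map (τ d i k) = F d i
  indep_wait : iIndepFun (fun (j : Dir × ℕ × ℕ) => τ j.1 j.2.1 j.2.2) μ
  indep_chain : IndepFun (fun ω (k : ℕ) => X k ω)
    (fun ω (j : Dir × ℕ × ℕ) => τ j.1 j.2.1 j.2.2 ω) μ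

section Paths

variable {Ω : Type*} (X : ℕ → Ω → ℕ) (τ : Dir → ℕ → ℕ → Ω → ℝ)

/-- The time between the `k`-th and the `(k+1)`-st jump. -/
def sojourn (k : ℕ) (ω : Ω) : ℝ :=
  if X (k + 1) ω = X k ω + 1 then τ Dir.right (X k ω) k ω else τ Dir.left (X k ω) k ω

/-- The jump times: `T 0 = 0`, `T (k+1) = T k + (k-th sojourn time)`. -/
def jumpTime (k : ℕ) (ω : Ω) : ℝ := ∑ j ∈ Finset.range k, sojourn X τ j ω

/-- `X(t) = n`, where the walk is `X(t) = X k` for `t ∈ [T k, T (k+1))`. -/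
def WalkAt (t : ℝ) (n : ℕ) (ω : Ω) : Prop :=
  ∃ k, jumpTime X τ k ω ≤ t ∧ t < jumpTime X τ (k + 1) ω ∧ X k ω = n

/-- `σ n = inf {t ≥ 0 | X(t) = n}`, with `inf ∅ = ∞`. -/
def hittingTime (n : ℕ) (ω : Ω) : ℝ≥0∞ :=
  ⨅ (t : ℝ≥0) (_ : WalkAt X τ (t : ℝ) n ω), (t : ℝ≥0∞)

/-- The event that the walk explodes: `σ n` converges to a finite limit. -/
def explosionEvent : Set Ω :=
  {ω | ∃ s : ℝ≥0, Tendsto (fun n => hittingTime X τ n ω) atTop (𝓝 (s : ℝ≥0∞))}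

/-- `sup_i P_i(σ_0 > C)`, where `P i` is the probability for the walk started at `i`. -/
def lateTail [MeasurableSpace Ω] (P : ℕ → Measure Ω) (C : ℝ≥0) : ℝ≥0∞ :=
  ⨆ i, P i {ω | (C : ℝ≥0∞) < hittingTime X τ 0 ω}

/-- Implosion from infinity: `lim_{C → ∞} sup_i P_i(σ_0 > C) = 0`. -/
def Implodes [MeasurableSpace Ω] (P : ℕ → Measure Ω) : Prop :=
  Tendsto (lateTail X τ P) atTop (𝓝 0)

end Paths

/-- The scale `δ_k = (q_1 ⋯ q_k) / (p_1 ⋯ p_k)`. -/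
def bdScale (p : ℕ → ℝ) (k : ℕ) : ℝ := ∏ j ∈ Finset.Icc 1 k, (1 - p j) / p j

/-- The Laplace transform at `1` of the sojourn time at `i`:
`p_i E exp(-τ_i⁺) + q_i E exp(-τ_i⁻)`. -/
def sojournLaplace (p : ℕ → ℝ) (F : Dir → ℕ → Measure ℝ) (i : ℕ) : ℝ :=
  p i * ∫ x, Real.exp (-x) ∂(F Dir.right i) + (1 - p i) * ∫ x, Real.exp (-x) ∂(F Dir.left i)

/-- The speed measure `ν_i = (1 - E exp(-τ_i)) (p_1 ⋯ p_{i-1}) / (q_1 ⋯ q_i)`. -/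
def bdSpeed (p : ℕ → ℝ) (F : Dir → ℕ → Measure ℝ) (i : ℕ) : ℝ :=
  (1 - sojournLaplace p F i) *
    ((∏ j ∈ Finset.Ico 1 i, p j) / ∏ j ∈ Finset.Icc 1 i, (1 - p j))

/-- General explosion condition: `∑_{k ≥ 0} (∑_{i ≤ k} ν_i) δ_k < ∞`. -/
def GeneralExplosionCondition (p : ℕ → ℝ) (F : Dir → ℕ → Measure ℝ) : Prop :=
  ∑' k : ℕ, (∑ i ∈ Finset.range (k + 1), ENNReal.ofReal (bdSpeed p F i)) *
    ENNReal.ofReal (bdScale p k) < ⊤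

/-- General implosion condition: `∑_{k ≥ 0} (∑_{i > k} ν_i) δ_k < ∞` and `∑ δ_k = ∞`. -/
def GeneralImplosionCondition (p : ℕ → ℝ) (F : Dir → ℕ → Measure ℝ) : Prop :=
  ∑' k : ℕ, (∑' i : ℕ, ENNReal.ofReal (bdSpeed p F (k + 1 + i))) *
    ENNReal.ofReal (bdScale p k) < ⊤ ∧
  ∑' k : ℕ, ENNReal.ofReal (bdScale p k) = ⊤

/-- `∑_{i ≥ 0} b_i ∑_{k ≥ i} (q_{i+1} ⋯ q_k) / (p_i ⋯ p_k) < ∞`. The inner sum is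
indexed by `k - i`. -/
def ExplosionSeriesFinite (p b : ℕ → ℝ) : Prop :=
  ∑' i : ℕ, ENNReal.ofReal (b i) *
    ∑' k : ℕ, ENNReal.ofReal
      ((∏ j ∈ Finset.Ioc i (i + k), (1 - p j)) / ∏ j ∈ Finset.Icc i (i + k), p j) < ⊤

/-- `∑_{i ≥ 1} b_i ∑_{k < i} (p_{k+1} ⋯ p_{i-1}) / (q_{k+1} ⋯ q_i) < ∞` and `∑ δ_k = ∞`. The
outer sum is indexed by `i - 1`. -/
def ImplosionSeriesCondition (p b : ℕ → ℝ) : Prop :=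
  ∑' i : ℕ, ENNReal.ofReal (b (i + 1)) *
    ∑ k ∈ Finset.range (i + 1), ENNReal.ofReal
      ((∏ j ∈ Finset.Ico (k + 1) (i + 1), p j) /
        ∏ j ∈ Finset.Icc (k + 1) (i + 1), (1 - p j)) < ⊤ ∧
  ∑' k : ℕ, ENNReal.ofReal (bdScale p k) = ⊤

/-- Explosion and implosion of every walk with transition probabilities `p` and waiting-time laws
`F` are decided by the series with weights `b`. -/
structure SeriesCriteria (p : ℕ → ℝ) (F : Dir → ℕ → Measure ℝ) (b : ℕ → ℝ) : Prop where
  general_explosion : GeneralExplosionCondition p F ↔ ExplosionSeriesFinite p b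
  general_implosion : GeneralImplosionCondition p F ↔ ImplosionSeriesCondition p b
  /-- the walk may have any initial distribution -/
  explosion : ∀ {Ω : Type u} [MeasurableSpace Ω] (X : ℕ → Ω → ℕ) (τ : Dir → ℕ → ℕ → Ω → ℝ)
    (μ : Measure Ω), IsCTRW p F X τ μ →
      (μ (explosionEvent X τ) = 1 ↔ ExplosionSeriesFinite p b) ∧
      (μ (explosionEvent X τ) = 0 ↔ ¬ ExplosionSeriesFinite p b)
  /-- under `P i` the walk starts at `i` -/
  implosion : ∀ {Ω : Type u} [MeasurableSpace Ω] (X : ℕ → Ω → ℕ) (τ : Dir → ℕ → ℕ → Ω → ℝ)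
    (P : ℕ → Measure Ω), (∀ i, IsCTRW p F X τ (P i)) → (∀ i, ∀ᵐ ω ∂(P i), X 0 ω = i) →
      (Implodes X τ P ↔ ImplosionSeriesCondition p b) ∧
      (Tendsto (lateTail X τ P) atTop (𝓝 1) ↔ ¬ ImplosionSeriesCondition p b)
  /-- the homogeneous case `p_i = r`, `q_i = 1 - r` for `i ≥ 1` -/
  homogeneous_explosion : ∀ r : ℝ, (∀ i, 1 ≤ i → p i = r) →
    (ExplosionSeriesFinite p b ↔ Summable b ∧ r > 1 - r)
  homogeneous_implosion : ∀ r : ℝ, (∀ i, 1 ≤ i → p i = r) →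
    (ImplosionSeriesCondition p b ↔
      (Summable b ∧ r < 1 - r) ∨ (Summable (fun i : ℕ => (i : ℝ) * b i) ∧ r = 1 - r))

/-- `m` is the law of a positive (strictly) `α`-stable random variable: the sum of `n` independent
copies has the law of `n^{1/α}` times one copy. -/
structure IsPositiveStable (α : ℝ) (m : Measure ℝ) : Prop where
  isProbabilityMeasure : IsProbabilityMeasure m
  pos : ∀ᵐ x ∂m, 0 < x
  stable : ∀ n : ℕ, 1 ≤ n →
    (Measure.pi (fun _ : Fin n => m)).map (fun x => ∑ i, x i) =
      m.map (fun x => (n : ℝ) ^ (1 / α) * x)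

end

/-! Waiting times are measured by the bounded cost 1 - e^{-t}: a series of positive times converges
as soon as its costs do. Let w_i be the mean cost of a sojourn at i, P the transition operator, δ
the scale and ρ the density of the speed measure. Detailed balance gives explicit solutions of w +
Pf = f: the tail of Σ_k δ_k Σ_{j≤k} w_j ρ_j for escape to infinity, and the partial sums of Σ_k δ_k
Σ_{j>k} w_j ρ_j for the passage to 0 (`poisson_explosion`, `poisson_implosion`).

Sufficiency. Such a solution bounds the mean total cost. If (E) holds, the total cost is almost
surely finite, so the clock converges and the chain leaves every finite set
(`ae_mem_explosionEvent`). If (I) holds, divergence of Σ δ_k makes the chain reach 0. With the cost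
1 - e^{-t/C} the bound on the mean cost is independent of the start and tends to 0 as C grows, and
Markov's inequality gives implosion (`measure_late_le`, `tendsto_lateTail_zero`).

Necessity. If f ≥ 1 and Pf ≤ f + w, discounting by e^{-t} absorbs the excess w, so e^{-T_n} f(X_n)
is a supermartingale off the target set (`laplaceOp_le_of_bdOp_le`). The probability of reaching a
set by time C from x is then at most e^C f(x) / inf f over that set (`measure_hit_le`). A barrier
tending to infinity excludes explosion. Barriers with f_n(n) / f_n(0) → 0 exclude fast arrival at 0
from far away. Both events thus obey a strict alternative.

Weights. Exchanging sums turns (E) and (I) into Σ w_i K_i with K_i ≥ 1, and (E_b), (I_b) into Σ b_i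
K_i with the same K. Hence c·min(1, b_i) ≤ w_i ≤ C·b_i suffices (`seriesCriteria_of_comparable`).
For finite means this follows from 1 - e^{-t} ≤ t and concavity; for stable laws, from the
functional equation of the Laplace transform. -/

/-! ### One step of the walk, conditioned on its history. -/

/-- The direction of the jump from `i` to `j`. -/
def Dir.ofJump (i j : ℕ) : Dir := if j = i + 1 then Dir.right else Dir.left

theorem sojourn_eq {Ω : Type*} (X : ℕ → Ω → ℕ) (τ : Dir → ℕ → ℕ → Ω → ℝ) (k : ℕ) (ω : Ω) :
    sojourn X τ k ω = τ (Dir.ofJump (X k ω) (X (k + 1) ω)) (X k ω) k ω := by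
  unfold sojourn Dir.ofJump
  split_ifs <;> rfl

/-- Decomposition of an integral along the values of a discrete random variable. -/
theorem lintegral_eq_tsum_fiber {Ω ι : Type*} [MeasurableSpace Ω] {μ : Measure Ω} [Countable ι]
    [MeasurableSpace ι] [MeasurableSingletonClass ι] {Z : Ω → ι} (hZ : Measurable Z)
    (f : Ω → ℝ≥0∞) : ∫⁻ ω, f ω ∂μ = ∑' z, ∫⁻ ω in Z ⁻¹' {z}, f ω ∂μ := by
  rw [← lintegral_iUnion (fun z => hZ (measurableSet_singleton z)), ← setLIntegral_univ]
  · congr 1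
    congr 1
    ext ω
    simp
  · intro a b hab
    refine Set.disjoint_left.2 fun ω ha hb => hab ?_
    simp only [Set.mem_preimage, Set.mem_singleton_iff] at ha hb
    exact ha.symm.trans hb

namespace IsCTRW

variable {Ω : Type u} [MeasurableSpace Ω] {p : ℕ → ℝ} {F : Dir → ℕ → Measure ℝ}
  {X : ℕ → Ω → ℕ} {τ : Dir → ℕ → ℕ → Ω → ℝ} {μ : Measure Ω}

theorem measurable_sojourn (h : IsCTRW p F X τ μ) (k : ℕ) : Measurable (sojourn X τ k) := by
  have hd : ∀ d, Measurable fun ω => τ d (X k ω) k ω := fun d => by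
    have h1 : Measurable fun q : ℕ × Ω => τ d q.1 k q.2 :=
      measurable_from_prod_countable_right fun i => h.measurable_wait d i k
    exact h1.comp ((h.measurable_chain k).prodMk measurable_id)
  refine Measurable.ite ?_ (hd _) (hd _)
  exact measurableSet_eq_fun (h.measurable_chain _) ((h.measurable_chain k).add_const 1)

theorem measurable_jumpTime (h : IsCTRW p F X τ μ) (k : ℕ) : Measurable (jumpTime X τ k) :=
  Finset.measurable_fun_sum _ fun j _ => h.measurable_sojourn j

theorem measurableSet_cylinder (h : IsCTRW p F X τ μ) (x : ℕ → ℕ) (m : ℕ) :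
    MeasurableSet {ω | ∀ k ≤ m, X k ω = x k} := by
  have : {ω | ∀ k ≤ m, X k ω = x k} = ⋂ k ∈ Set.Iic m, X k ⁻¹' {x k} := by
    ext ω; simp
  rw [this]
  exact MeasurableSet.biInter (Set.to_countable _) fun k _ =>
    h.measurable_chain k (measurableSet_singleton _)

/-- The waiting times are independent of the path of the chain. -/
theorem setLIntegral_cylinder (h : IsCTRW p F X τ μ) (x : ℕ → ℕ) (m : ℕ)
    {Φ : (Dir × ℕ × ℕ → ℝ) → ℝ≥0∞} (hΦ : Measurable Φ) :
    ∫⁻ ω in {ω | ∀ k ≤ m, X k ω = x k}, Φ (fun j => τ j.1 j.2.1 j.2.2 ω) ∂μ =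
      μ {ω | ∀ k ≤ m, X k ω = x k} * ∫⁻ ω, Φ (fun j => τ j.1 j.2.1 j.2.2 ω) ∂μ := by
  have hC := h.measurableSet_cylinder x m
  have hB : MeasurableSet {y : ℕ → ℕ | ∀ k ≤ m, y k = x k} := by
    have : {y : ℕ → ℕ | ∀ k ≤ m, y k = x k} = ⋂ k ∈ Set.Iic m, (fun y => y k) ⁻¹' {x k} := by
      ext ω; simp
    rw [this]
    exact MeasurableSet.biInter (Set.to_countable _) fun k _ =>
      measurable_pi_apply k (measurableSet_singleton _)
  have hτ : Measurable fun ω (j : Dir × ℕ × ℕ) => τ j.1 j.2.1 j.2.2 ω :=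
    measurable_pi_lambda _ fun j => h.measurable_wait _ _ _
  have hX : Measurable fun ω (k : ℕ) => X k ω := measurable_pi_lambda _ h.measurable_chain
  have hu : Measurable ({y : ℕ → ℕ | ∀ k ≤ m, y k = x k}.indicator (1 : (ℕ → ℕ) → ℝ≥0∞)) :=
    measurable_one.indicator hB
  have key := lintegral_mul_eq_lintegral_mul_lintegral_of_indepFun
    (hu.comp hX) (hΦ.comp hτ) (h.indep_chain.comp hu hΦ)
  rw [← lintegral_indicator hC]
  have e1 : (({y : ℕ → ℕ | ∀ k ≤ m, y k = x k}.indicator (1 : (ℕ → ℕ) → ℝ≥0∞)) ∘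
      fun ω (k : ℕ) => X k ω) = {ω | ∀ k ≤ m, X k ω = x k}.indicator 1 := by
    ext ω
    simp [Set.indicator]
  rw [e1, lintegral_indicator_one hC] at key
  simp only [Function.comp_def] at key
  rw [← key]
  refine lintegral_congr fun ω => ?_
  by_cases hω : ω ∈ {ω | ∀ k ≤ m, X k ω = x k} <;> simp [Set.indicator, hω]

/-- Along a fixed path, the last waiting time is independent of the previous ones. -/
theorem lintegral_wait_mul (h : IsCTRW p F X τ μ) (g : ℕ → Dir × ℕ) (n : ℕ)
    {G : (Fin n → ℝ) → ℝ≥0∞} (hG : Measurable G) {ψ : ℝ → ℝ≥0∞} (hψ : Measurable ψ) :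
    ∫⁻ ω, G (fun k => τ (g k).1 (g k).2 k ω) * ψ (τ (g n).1 (g n).2 n ω) ∂μ =
      (∫⁻ ω, G (fun k => τ (g k).1 (g k).2 k ω) ∂μ) * ∫⁻ t, ψ t ∂F (g n).1 (g n).2 := by
  -- The step number is part of the index, so a path that returns to a state uses a fresh copy
  -- there.
  have hinj : Function.Injective fun k : ℕ => ((g k).1, (g k).2, k) := fun a b hab => by
    simpa using congrArg (fun z : Dir × ℕ × ℕ => z.2.2) hab
  have hind := h.indep_wait.precomp hinj
  have hm : ∀ k : ℕ, Measurable (τ (g k).1 (g k).2 k) := fun k => h.measurable_wait _ _ _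
  have hfin := hind.indepFun_finset (Finset.range n) {n} (by simp) hm
  have hG' : Measurable fun t : (Finset.range n → ℝ) =>
      G fun k => t ⟨k, Finset.mem_range.2 k.2⟩ :=
    hG.comp (measurable_pi_lambda _ fun k => measurable_pi_apply _)
  have hψ' : Measurable fun t : (({n} : Finset ℕ) → ℝ) => ψ (t ⟨n, by simp⟩) :=
    hψ.comp (measurable_pi_apply _)
  have key := lintegral_mul_eq_lintegral_mul_lintegral_of_indepFun
    (hG'.comp (measurable_pi_lambda _ fun k : Finset.range n => hm k))
    (hψ'.comp (measurable_pi_lambda _ fun k : ({n} : Finset ℕ) => hm k)) (hfin.comp hG' hψ')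
  simp only [Function.comp_def, Pi.mul_apply] at key
  rw [key, ← h.law_wait (g n).1 (g n).2 n, lintegral_map hψ (hm n)]

/-- The mean of `ψ i j t` over the next jump `i → j` and the waiting time `t` before it. -/
noncomputable def _root_.stepMean (p : ℕ → ℝ) (F : Dir → ℕ → Measure ℝ) (ψ : ℕ → ℕ → ℝ → ℝ≥0∞)
    (i : ℕ) : ℝ≥0∞ :=
  ENNReal.ofReal (p i) * ∫⁻ t, ψ i (i + 1) t ∂F Dir.right i +
    ENNReal.ofReal (1 - p i) * ∫⁻ t, ψ i (i - 1) t ∂F Dir.left i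

/-- Only neighbours carry mass. At state 0 the truncated `0 - 1 = 0` in `stepMean` is harmless,
because its coefficient `1 - p 0` vanishes. -/
theorem _root_.tsum_bdTrans (hp : IsBirthDeath p) (i : ℕ) (ψ : ℕ → ℕ → ℝ → ℝ≥0∞) :
    ∑' j, ENNReal.ofReal (bdTrans p i j) * ∫⁻ t, ψ i j t ∂F (Dir.ofJump i j) i =
      stepMean p F ψ i := by
  unfold stepMean
  rcases i with _ | i
  · rw [tsum_eq_single 1]
    · simp [bdTrans, Dir.ofJump, hp.1]
    · intro j hj
      simp [bdTrans, hj]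
  · rw [← ENNReal.sum_add_tsum_compl {i + 2, i}, ENNReal.tsum_eq_zero.2, add_zero]
    · rw [Finset.sum_pair (by simp)]
      have : ¬ i = i + 1 + 1 := by omega
      simp [bdTrans, Dir.ofJump, this]
    · rintro ⟨j, hj⟩
      simp only [Finset.coe_insert, Finset.coe_singleton, Set.mem_compl_iff, Set.mem_insert_iff,
        Set.mem_singleton_iff, not_or] at hj
      have h1 : ¬ (i = j) := fun h => hj.2 h.symm
      simp [bdTrans, hj.1, h1]

/-- One step of the walk, given its history up to the `n`-th jump. -/
theorem lintegral_step (h : IsCTRW p F X τ μ) (hp : IsBirthDeath p) (n : ℕ)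
    {G : (Fin (n + 1) → ℕ) → (Fin n → ℝ) → ℝ≥0∞} (hG : ∀ x, Measurable (G x))
    {ψ : ℕ → ℕ → ℝ → ℝ≥0∞} (hψ : ∀ i j, Measurable (ψ i j)) :
    ∫⁻ ω, G (fun k => X k ω) (fun k => sojourn X τ k ω) *
        ψ (X n ω) (X (n + 1) ω) (sojourn X τ n ω) ∂μ =
      ∫⁻ ω, G (fun k => X k ω) (fun k => sojourn X τ k ω) * stepMean p F ψ (X n ω) ∂μ := by
  have hY : Measurable fun ω (k : Fin (n + 1)) => X k ω :=
    measurable_pi_lambda _ fun k => h.measurable_chain k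
  rw [lintegral_eq_tsum_fiber (hY.prodMk (h.measurable_chain (n + 1))), ENNReal.tsum_prod',
    lintegral_eq_tsum_fiber hY]
  refine tsum_congr fun y => ?_
  -- The history `y` is continued by the candidate next state `j`. Values beyond index `n + 1` are
  -- never read.
  let x : ℕ → ℕ → ℕ := fun j k => if hk : k < n + 1 then y ⟨k, hk⟩ else j
  have hx : ∀ j k (hk : k < n + 1), x j k = y ⟨k, hk⟩ := fun j k hk => dif_pos hk
  have hxj : ∀ j, x j (n + 1) = j := fun j => dif_neg (by simp)
  let g : ℕ → ℕ → Dir × ℕ := fun j k => (Dir.ofJump (x j k) (x j (k + 1)), x j k)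
  have hC : ∀ j, (fun ω (k : Fin (n + 1)) => X k ω) ⁻¹' {y} = {ω | ∀ k ≤ n, X k ω = x j k} := by
    intro j
    ext ω
    simp only [Set.mem_preimage, Set.mem_singleton_iff, funext_iff, Set.mem_ofPred_eq]
    exact ⟨fun H k hk => by rw [hx j k (by omega)]; exact H ⟨k, by omega⟩,
      fun H k => by rw [H k (by omega), hx j k k.2]⟩
  have hD : ∀ j, (fun ω => ((fun k : Fin (n + 1) => X k ω), X (n + 1) ω)) ⁻¹' {(y, j)} =
      {ω | ∀ k ≤ n + 1, X k ω = x j k} := by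
    intro j
    ext ω
    simp only [Set.mem_preimage, Set.mem_singleton_iff, Prod.mk.injEq, funext_iff,
      Set.mem_ofPred_eq]
    refine ⟨fun H k hk => ?_, fun H => ⟨fun k => by rw [H k (by omega), hx j k k.2],
      by rw [H _ le_rfl, hxj]⟩⟩
    rcases Nat.lt_or_ge k (n + 1) with hk' | hk'
    · rw [hx j k hk']; exact H.1 ⟨k, hk'⟩
    · obtain rfl : k = n + 1 := by omega
      rw [hxj, H.2]
  have hdir : ∀ ω j k, (∀ k ≤ n + 1, X k ω = x j k) → k ≤ n →
      sojourn X τ k ω = τ (g j k).1 (g j k).2 k ω := by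
    intro ω j k H hk
    rw [sojourn_eq, H k (by omega), H (k + 1) (by omega)]
  have hdir' : ∀ ω j k, (∀ k ≤ n, X k ω = x j k) → k < n →
      sojourn X τ k ω = τ (g j k).1 (g j k).2 k ω := by
    intro ω j k H hk
    rw [sojourn_eq, H k (by omega), H (k + 1) (by omega)]
  -- The waiting times before step `n` do not see the next state, so the factor `I` is common to all
  -- `j` and leaves the sum.
  have hg0 : ∀ j (k : Fin n), g j k = g 0 k := fun j k => by
    simp only [g]
    rw [hx j k (by omega), hx j (k + 1) (by omega), hx 0 k (by omega), hx 0 (k + 1) (by omega)]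
  set I := ∫⁻ ω, G y (fun k => τ (g 0 k).1 (g 0 k).2 k ω) ∂μ with hI
  have hmeas : ∀ j, Measurable fun t : Dir × ℕ × ℕ → ℝ =>
      G y (fun k : Fin n => t ((g j k).1, (g j k).2, k)) := fun j =>
    (hG y).comp (measurable_pi_lambda _ fun k => measurable_pi_apply _)
  have hleft : ∀ j, ∫⁻ ω in (fun ω => ((fun k : Fin (n + 1) => X k ω), X (n + 1) ω)) ⁻¹' {(y, j)},
      G (fun k => X k ω) (fun k => sojourn X τ k ω) *
        ψ (X n ω) (X (n + 1) ω) (sojourn X τ n ω) ∂μ =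
      μ {ω | ∀ k ≤ n, X k ω = x 0 k} * I *
        (ENNReal.ofReal (bdTrans p (y (Fin.last n)) j) *
          ∫⁻ t, ψ (y (Fin.last n)) j t ∂F (Dir.ofJump (y (Fin.last n)) j) (y (Fin.last n))) := by
    intro j
    have hn : x j n = y (Fin.last n) := hx j n (by omega)
    rw [hD, setLIntegral_congr_fun (h.measurableSet_cylinder (x j) (n + 1))
      (g := fun ω => G y (fun k => τ (g j k).1 (g j k).2 k ω) *
        ψ (y (Fin.last n)) j (τ (g j n).1 (g j n).2 n ω))]
    · rw [h.setLIntegral_cylinder (x j) (n + 1)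
        (Φ := fun t => G y (fun k => t ((g j k).1, (g j k).2, k)) *
          ψ (y (Fin.last n)) j (t ((g j n).1, (g j n).2, n)))
        ((hmeas j).mul ((hψ _ _).comp (measurable_pi_apply _))),
        h.lintegral_wait_mul (g j) n (hG y) (hψ _ _), h.markov]
      have e1 : g j n = (Dir.ofJump (y (Fin.last n)) j, y (Fin.last n)) := by
        simp only [g, hn, hxj]
      have e2 : ∫⁻ ω, G y (fun k => τ (g j k).1 (g j k).2 k ω) ∂μ = I := by
        simp only [hg0, hI]
      rw [e1, e2, hn, hxj, ← hC j, ← hC 0]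
      ring
    · intro ω hω
      have hω' : ∀ k ≤ n + 1, X k ω = x j k := hω
      have e1 : (fun k : Fin (n + 1) => X k ω) = y := by
        ext k
        rw [hω' k (by omega), hx j k k.2]
      simp only
      rw [e1, hdir ω j n hω' le_rfl, hω' n (by omega), hω' (n + 1) le_rfl, hn, hxj]
      congr 2
      ext k
      exact hdir ω j k hω' (by omega)
  have hright : ∫⁻ ω in (fun ω (k : Fin (n + 1)) => X k ω) ⁻¹' {y},
      G (fun k => X k ω) (fun k => sojourn X τ k ω) * stepMean p F ψ (X n ω) ∂μ =
      μ {ω | ∀ k ≤ n, X k ω = x 0 k} * I * stepMean p F ψ (y (Fin.last n)) := by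
    rw [hC 0, setLIntegral_congr_fun (h.measurableSet_cylinder (x 0) n)
      (g := fun ω => G y (fun k => τ (g 0 k).1 (g 0 k).2 k ω) *
        stepMean p F ψ (y (Fin.last n)))]
    · rw [h.setLIntegral_cylinder (x 0) n
        (Φ := fun t => G y (fun k => t ((g 0 k).1, (g 0 k).2, k)) *
          stepMean p F ψ (y (Fin.last n))) ((hmeas 0).mul_const _),
        lintegral_mul_const, mul_assoc]
      exact (hG y).comp (measurable_pi_lambda _ fun k => h.measurable_wait _ _ _)
    · intro ω hω
      have hω' : ∀ k ≤ n, X k ω = x 0 k := hω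
      have e1 : (fun k : Fin (n + 1) => X k ω) = y := by
        ext k
        rw [hω' k (by omega), hx 0 k k.2]
      simp only
      rw [e1, hω' n le_rfl, hx 0 n (by omega)]
      congr 2
      ext k
      exact hdir' ω 0 k hω' k.2
  rw [hright, tsum_congr hleft, ENNReal.tsum_mul_left, tsum_bdTrans hp]

end IsCTRW

/-! ### Supermartingale bounds for costs and discounted hitting. -/

open Classical in
/-- The indicator of the event that the chain avoids `S` before time `n`. -/
noncomputable def aliveInd {Ω : Type*} (X : ℕ → Ω → ℕ) (S : Set ℕ) (n : ℕ) (ω : Ω) : ℝ≥0∞ :=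
  if ∀ j < n, X j ω ∉ S then 1 else 0

/-- The mean of a function of the waiting time at `i`. -/
noncomputable def waitMean (p : ℕ → ℝ) (F : Dir → ℕ → Measure ℝ) (c : ℝ → ℝ≥0∞) (i : ℕ) : ℝ≥0∞ :=
  ENNReal.ofReal (p i) * ∫⁻ t, c t ∂F Dir.right i +
    ENNReal.ofReal (1 - p i) * ∫⁻ t, c t ∂F Dir.left i

/-- The transition operator of the chain. -/
noncomputable def bdOp (p : ℕ → ℝ) (f : ℕ → ℝ≥0∞) (i : ℕ) : ℝ≥0∞ :=
  ENNReal.ofReal (p i) * f (i + 1) + ENNReal.ofReal (1 - p i) * f (i - 1)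

theorem IsBirthDeath.ofReal_add {p : ℕ → ℝ} (hp : IsBirthDeath p) (i : ℕ) :
    ENNReal.ofReal (p i) + ENNReal.ofReal (1 - p i) = 1 := by
  rcases Nat.eq_zero_or_pos i with rfl | hi
  · simp [hp.1]
  · rw [← ENNReal.ofReal_add (hp.2 i hi).1.le (hp.2 i hi).2.le]
    simp

theorem aliveInd_zero {Ω : Type*} (X : ℕ → Ω → ℕ) (S : Set ℕ) (ω : Ω) :
    aliveInd X S 0 ω = 1 := by
  simp [aliveInd]

theorem aliveInd_of_forall {Ω : Type*} {X : ℕ → Ω → ℕ} {S : Set ℕ} {n : ℕ} {ω : Ω}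
    (h : ∀ j < n, X j ω ∉ S) : aliveInd X S n ω = 1 := if_pos h

theorem aliveInd_succ_of_mem {Ω : Type*} {X : ℕ → Ω → ℕ} {S : Set ℕ} {n : ℕ} {ω : Ω}
    (h : X n ω ∈ S) : aliveInd X S (n + 1) ω = 0 :=
  if_neg fun H => H n (Nat.lt_succ_self n) h

theorem aliveInd_succ_of_notMem {Ω : Type*} {X : ℕ → Ω → ℕ} {S : Set ℕ} {n : ℕ} {ω : Ω}
    (h : X n ω ∉ S) : aliveInd X S (n + 1) ω = aliveInd X S n ω := by
  unfold aliveInd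
  congr 1
  refine propext ⟨fun H j hj => H j (hj.trans (Nat.lt_succ_self n)), fun H j hj => ?_⟩
  rcases Nat.lt_succ_iff_lt_or_eq.1 hj with hj | rfl
  exacts [H j hj, h]

namespace IsCTRW

variable {Ω : Type u} [MeasurableSpace Ω] {p : ℕ → ℝ} {F : Dir → ℕ → Measure ℝ}
  {X : ℕ → Ω → ℕ} {τ : Dir → ℕ → ℕ → Ω → ℝ} {μ : Measure Ω}

theorem isProbabilityMeasure_law (h : IsCTRW p F X τ μ) (d : Dir) (i : ℕ) :
    IsProbabilityMeasure (F d i) := by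
  have := h.isProbabilityMeasure
  rw [← h.law_wait d i 0]
  exact Measure.isProbabilityMeasure_map (h.measurable_wait d i 0).aemeasurable

theorem measurable_aliveInd (h : IsCTRW p F X τ μ) (S : Set ℕ) (n : ℕ) :
    Measurable (aliveInd X S n) := by
  refine Measurable.ite ?_ measurable_const measurable_const
  have : {ω | ∀ j < n, X j ω ∉ S} = ⋂ j ∈ Set.Iio n, X j ⁻¹' Sᶜ := by
    ext ω; simp
  rw [this]
  exact MeasurableSet.biInter (Set.to_countable _) fun k _ =>
    h.measurable_chain k (MeasurableSet.of_discrete)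

theorem measurable_comp_chain (h : IsCTRW p F X τ μ) {β : Type*} [MeasurableSpace β]
    (f : ℕ → β) (n : ℕ) : Measurable fun ω => f (X n ω) :=
  (measurable_of_countable f).comp (h.measurable_chain n)

/-- Expected cost collected before hitting `S`, in one step. -/
theorem lintegral_aliveInd_mul_sojourn (h : IsCTRW p F X τ μ) (hp : IsBirthDeath p) (S : Set ℕ)
    {c : ℝ → ℝ≥0∞} (hc : Measurable c) (f : ℕ → ℝ≥0∞) (n : ℕ) :
    ∫⁻ ω, aliveInd X S (n + 1) ω * (c (sojourn X τ n ω) + f (X (n + 1) ω)) ∂μ =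
      ∫⁻ ω, aliveInd X S (n + 1) ω * (waitMean p F c (X n ω) + bdOp p f (X n ω)) ∂μ := by
  classical
  have hF := h.isProbabilityMeasure_law
  have key := h.lintegral_step hp n
    (G := fun y _ => if ∀ k, y k ∉ S then 1 else 0) (fun _ => measurable_const)
    (ψ := fun _ j t => c t + f j) (fun _ j => hc.add_const _)
  have e : ∀ ω, (if ∀ k : Fin (n + 1), X k ω ∉ S then (1 : ℝ≥0∞) else 0) =
      aliveInd X S (n + 1) ω := fun ω => by
    unfold aliveInd
    congr 1
    exact propext ⟨fun H j hj => H ⟨j, hj⟩, fun H k => H k k.2⟩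
  have e2 : ∀ i, stepMean p F (fun _ j t => c t + f j) i = waitMean p F c i + bdOp p f i := by
    intro i
    unfold stepMean waitMean bdOp
    simp only [lintegral_add_right _ measurable_const, lintegral_const, measure_univ, mul_one]
    ring
  simp only [e, e2] at key
  exact key

theorem measurable_aliveInd_mul_cost (h : IsCTRW p F X τ μ) (S : Set ℕ)
    {c : ℝ → ℝ≥0∞} (hc : Measurable c) (n : ℕ) :
    Measurable fun ω => aliveInd X S (n + 1) ω * c (sojourn X τ n ω) :=
  (h.measurable_aliveInd S (n + 1)).mul (hc.comp (h.measurable_sojourn n))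

theorem measurable_aliveInd_mul_comp (h : IsCTRW p F X τ μ) (S : Set ℕ) (f : ℕ → ℝ≥0∞)
    (m n : ℕ) : Measurable fun ω => aliveInd X S m ω * f (X n ω) :=
  (h.measurable_aliveInd S m).mul (h.measurable_comp_chain f n)

/-- Costs of the waiting times are bounded by a superharmonic function. -/
theorem sum_cost_add_le (h : IsCTRW p F X τ μ) (hp : IsBirthDeath p) (S : Set ℕ)
    {c : ℝ → ℝ≥0∞} (hc : Measurable c) {f : ℕ → ℝ≥0∞}
    (hf : ∀ i, i ∉ S → waitMean p F c i + bdOp p f i ≤ f i) (n : ℕ) :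
    ∑ k ∈ Finset.range n, ∫⁻ ω, aliveInd X S (k + 1) ω * c (sojourn X τ k ω) ∂μ +
      ∫⁻ ω, aliveInd X S n ω * f (X n ω) ∂μ ≤ ∫⁻ ω, f (X 0 ω) ∂μ := by
  induction n with
  | zero => simp [aliveInd_zero]
  | succ n ih =>
    refine le_trans ?_ ih
    rw [Finset.sum_range_succ, add_assoc]
    gcongr
    rw [← lintegral_add_left (h.measurable_aliveInd_mul_cost S hc n)]
    simp only [← mul_add]
    rw [h.lintegral_aliveInd_mul_sojourn hp S hc f n]
    refine lintegral_mono fun ω => ?_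
    by_cases hω : X n ω ∈ S
    · simp [aliveInd_succ_of_mem hω]
    · rw [aliveInd_succ_of_notMem hω]
      gcongr
      exact hf _ hω

theorem lintegral_alive_cost (h : IsCTRW p F X τ μ) (hp : IsBirthDeath p) (S : Set ℕ)
    {c : ℝ → ℝ≥0∞} (hc : Measurable c) (n : ℕ) :
    ∫⁻ ω, aliveInd X S (n + 1) ω * c (sojourn X τ n ω) ∂μ =
      ∫⁻ ω, aliveInd X S (n + 1) ω * waitMean p F c (X n ω) ∂μ := by
  simpa [bdOp] using h.lintegral_aliveInd_mul_sojourn hp S hc 0 n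

/-- The terminal term in `sum_cost_add_le` is nonnegative and can be dropped, so no boundary
condition on `f` at infinity is needed. -/
theorem lintegral_tsum_cost_le (h : IsCTRW p F X τ μ) (hp : IsBirthDeath p) (S : Set ℕ)
    {c : ℝ → ℝ≥0∞} (hc : Measurable c) {f : ℕ → ℝ≥0∞}
    (hf : ∀ i, i ∉ S → waitMean p F c i + bdOp p f i ≤ f i) :
    ∫⁻ ω, ∑' k, aliveInd X S (k + 1) ω * c (sojourn X τ k ω) ∂μ ≤ ∫⁻ ω, f (X 0 ω) ∂μ := by
  rw [lintegral_tsum fun k => (h.measurable_aliveInd_mul_cost S hc k).aemeasurable]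
  exact ENNReal.tsum_le_of_sum_range_le fun n =>
    le_self_add.trans (h.sum_cost_add_le hp S hc hf n)

/-- Replacing each cost by its mean given the current state preserves the expectation. The resulting
sum depends on the chain alone, and its finiteness is what shows that surviving paths go to
infinity. -/
theorem lintegral_tsum_waitMean_le (h : IsCTRW p F X τ μ) (hp : IsBirthDeath p) (S : Set ℕ)
    {c : ℝ → ℝ≥0∞} (hc : Measurable c) {f : ℕ → ℝ≥0∞}
    (hf : ∀ i, i ∉ S → waitMean p F c i + bdOp p f i ≤ f i) :
    ∫⁻ ω, ∑' k, aliveInd X S (k + 1) ω * waitMean p F c (X k ω) ∂μ ≤ ∫⁻ ω, f (X 0 ω) ∂μ := by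
  refine le_trans (le_of_eq ?_) (h.lintegral_tsum_cost_le hp S hc hf)
  rw [lintegral_tsum fun k => (h.measurable_aliveInd_mul_cost S hc k).aemeasurable,
    lintegral_tsum fun k => (h.measurable_aliveInd_mul_comp S _ (k + 1) k).aemeasurable]
  exact tsum_congr fun k => (h.lintegral_alive_cost hp S hc k).symm

/-- The discount factor `exp (- T n)`. -/
noncomputable def _root_.discount {Ω : Type*} (X : ℕ → Ω → ℕ) (τ : Dir → ℕ → ℕ → Ω → ℝ) (n : ℕ)
    (ω : Ω) : ℝ≥0∞ :=
  ENNReal.ofReal (Real.exp (-jumpTime X τ n ω))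

theorem measurable_discount (h : IsCTRW p F X τ μ) (n : ℕ) : Measurable (discount X τ n) :=
  (Real.measurable_exp.comp (h.measurable_jumpTime n).neg).ennreal_ofReal

/-- The discounted transition operator of the walk. -/
noncomputable def _root_.laplaceOp (p : ℕ → ℝ) (F : Dir → ℕ → Measure ℝ) (f : ℕ → ℝ≥0∞) (i : ℕ) :
    ℝ≥0∞ :=
  ENNReal.ofReal (p i) * ((∫⁻ t, ENNReal.ofReal (Real.exp (-t)) ∂F Dir.right i) * f (i + 1)) +
    ENNReal.ofReal (1 - p i) *
      ((∫⁻ t, ENNReal.ofReal (Real.exp (-t)) ∂F Dir.left i) * f (i - 1))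

/-- The weight `r (X 0)` is carried along to localise at one starting state, since `f (X 0)` need
not be integrable under a general initial distribution. -/
theorem lintegral_discount_step (h : IsCTRW p F X τ μ) (hp : IsBirthDeath p) (S : Set ℕ)
    (r f : ℕ → ℝ≥0∞) (n : ℕ) :
    ∫⁻ ω, r (X 0 ω) * (aliveInd X S (n + 1) ω * (discount X τ (n + 1) ω * f (X (n + 1) ω))) ∂μ =
      ∫⁻ ω, r (X 0 ω) * (aliveInd X S (n + 1) ω * (discount X τ n ω * laplaceOp p F f (X n ω)))
        ∂μ := by
  classical
  have hexp : Measurable fun t : ℝ => ENNReal.ofReal (Real.exp (-t)) :=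
    (Real.measurable_exp.comp measurable_neg).ennreal_ofReal
  have key := h.lintegral_step hp n
    (G := fun y t => r (y 0) * ((if ∀ k, y k ∉ S then 1 else 0) *
      ENNReal.ofReal (Real.exp (-∑ k, t k))))
    (fun y => ((hexp.comp (Finset.univ.measurable_sum
      fun k _ => measurable_pi_apply k)).const_mul _).const_mul _)
    (ψ := fun _ j t => ENNReal.ofReal (Real.exp (-t)) * f j) (fun _ j => hexp.mul_const _)
  have e : ∀ ω, (if ∀ k : Fin (n + 1), X k ω ∉ S then (1 : ℝ≥0∞) else 0) =
      aliveInd X S (n + 1) ω := fun ω => by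
    unfold aliveInd
    congr 1
    exact propext ⟨fun H j hj => H ⟨j, hj⟩, fun H k => H k k.2⟩
  have e1 : ∀ ω, ENNReal.ofReal (Real.exp (-∑ k : Fin n, sojourn X τ k ω)) = discount X τ n ω :=
    fun ω => by
      unfold discount jumpTime
      rw [Finset.sum_range fun k => sojourn X τ k ω]
  have e2 : ∀ i, stepMean p F (fun _ j t => ENNReal.ofReal (Real.exp (-t)) * f j) i =
      laplaceOp p F f i := by
    intro i
    unfold stepMean laplaceOp
    simp only [lintegral_mul_const _ hexp]
  have e3 : ∀ ω, discount X τ (n + 1) ω =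
      discount X τ n ω * ENNReal.ofReal (Real.exp (-sojourn X τ n ω)) := fun ω => by
    unfold discount jumpTime
    rw [← ENNReal.ofReal_mul (Real.exp_pos _).le, ← Real.exp_add, Finset.sum_range_succ]
    congr 2
    ring
  simp only [e, e1, e2] at key
  simp only [e3]
  calc _ = _ := lintegral_congr fun ω => by simp only [Fin.val_zero, ← mul_assoc]
    _ = _ := key
    _ = _ := lintegral_congr fun ω => by simp only [Fin.val_zero, ← mul_assoc]

/-- Discounted hitting distributions are bounded by a superharmonic function. -/
theorem sum_discount_add_le (h : IsCTRW p F X τ μ) (hp : IsBirthDeath p) (S : Set ℕ)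
    (r : ℕ → ℝ≥0∞) {f : ℕ → ℝ≥0∞} (hf : ∀ i, i ∉ S → laplaceOp p F f i ≤ f i) (n : ℕ) :
    ∑ k ∈ Finset.range n, ∫⁻ ω, r (X 0 ω) * (aliveInd X S k ω *
        (discount X τ k ω * S.indicator f (X k ω))) ∂μ +
      ∫⁻ ω, r (X 0 ω) * (aliveInd X S n ω * (discount X τ n ω * f (X n ω))) ∂μ ≤
        ∫⁻ ω, r (X 0 ω) * f (X 0 ω) ∂μ := by
  induction n with
  | zero => simp [aliveInd_zero, discount, jumpTime]
  | succ n ih =>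
    refine le_trans ?_ ih
    rw [Finset.sum_range_succ, add_assoc]
    gcongr
    rw [h.lintegral_discount_step hp S r f n, ← lintegral_add_left]
    · refine lintegral_mono fun ω => ?_
      simp only
      rw [← mul_add]
      gcongr
      by_cases hω : X n ω ∈ S
      · simp [aliveInd_succ_of_mem hω, hω]
      · rw [aliveInd_succ_of_notMem hω, Set.indicator_of_notMem hω]
        simp only [mul_zero, zero_add]
        gcongr
        exact hf _ hω
    · exact (h.measurable_comp_chain r 0).mul ((h.measurable_aliveInd S n).mul
        ((h.measurable_discount n).mul (h.measurable_comp_chain _ n)))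

/-- The probability of reaching `S` before time `C`, when the chain starts at `x`. -/
theorem measure_hit_le (h : IsCTRW p F X τ μ) (hp : IsBirthDeath p) (S : Set ℕ) (x : ℕ) (C : ℝ)
    {f : ℕ → ℝ≥0∞} (hf : ∀ i, i ∉ S → laplaceOp p F f i ≤ f i) {a : ℝ≥0∞} (ha : ∀ i ∈ S, a ≤ f i) :
    μ {ω | X 0 ω = x ∧ ∃ m, X m ω ∈ S ∧ (∀ j < m, X j ω ∉ S) ∧ jumpTime X τ m ω ≤ C} *
      (ENNReal.ofReal (Real.exp (-C)) * a) ≤ f x := by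
  have := h.isProbabilityMeasure
  let r : ℕ → ℝ≥0∞ := Set.indicator {x} 1
  let Y : ℕ → Ω → ℝ≥0∞ := fun k ω => r (X 0 ω) * (aliveInd X S k ω *
        (discount X τ k ω * S.indicator f (X k ω)))
  have hY : ∀ k, Measurable (Y k) := fun k =>
    (h.measurable_comp_chain r 0).mul ((h.measurable_aliveInd S k).mul
        ((h.measurable_discount k).mul (h.measurable_comp_chain _ k)))
  have h1 : ∫⁻ ω, ∑' k, Y k ω ∂μ ≤ f x := by
    rw [lintegral_tsum fun k => (hY k).aemeasurable]
    refine ENNReal.tsum_le_of_sum_range_le fun n =>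
      (le_self_add.trans (h.sum_discount_add_le hp S r hf n)).trans ?_
    calc _ ≤ ∫⁻ _, f x ∂μ := by
          refine lintegral_mono fun ω => ?_
          by_cases hω : X 0 ω = x <;> simp [r, hω]
      _ = f x := by simp
  refine le_trans ?_ h1
  rw [mul_comm]
  refine le_trans ?_ (mul_meas_ge_le_lintegral (Measurable.tsum hY)
    (ENNReal.ofReal (Real.exp (-C)) * a))
  gcongr with ω
  rintro ⟨hx, m, hm, hj, hC⟩
  -- The summand at the first entrance time `m` alone is large enough: there the discount is at
  -- least e^{-C}.
  refine le_trans ?_ (ENNReal.le_tsum m)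
  simp only [Y, r, hx, aliveInd_of_forall hj, Set.indicator_of_mem hm, Set.mem_singleton_iff,
    Set.indicator_of_mem, Pi.one_apply, one_mul]
  unfold discount
  gcongr
  exact ha _ hm

end IsCTRW

/-! ### Scale, speed and explicit solutions of the Poisson equation. -/

/-- The scale `δ_k` in `ℝ≥0∞`. -/
noncomputable def scaleE (p : ℕ → ℝ) (k : ℕ) : ℝ≥0∞ := ENNReal.ofReal (bdScale p k)

/-- The density `(p_1 ⋯ p_{i-1}) / (q_1 ⋯ q_i)` of the speed measure. -/
noncomputable def speedDensity (p : ℕ → ℝ) (i : ℕ) : ℝ≥0∞ :=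
  ENNReal.ofReal ((∏ j ∈ Finset.Ico 1 i, p j) / ∏ j ∈ Finset.Icc 1 i, (1 - p j))

namespace IsBirthDeath

variable {p : ℕ → ℝ}

theorem pos (hp : IsBirthDeath p) (i : ℕ) : 0 < p i := by
  rcases Nat.eq_zero_or_pos i with rfl | hi
  · simp [hp.1]
  · exact (hp.2 i hi).1

theorem nonneg (hp : IsBirthDeath p) (i : ℕ) : 0 ≤ 1 - p i := by
  rcases Nat.eq_zero_or_pos i with rfl | hi
  · simp [hp.1]
  · exact (hp.2 i hi).2.le

theorem le_one (hp : IsBirthDeath p) (i : ℕ) : p i ≤ 1 := sub_nonneg.1 (hp.nonneg i)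

theorem bdScale_pos (hp : IsBirthDeath p) (k : ℕ) : 0 < bdScale p k :=
  Finset.prod_pos fun j hj => div_pos (hp.2 j (Finset.mem_Icc.1 hj).1).2 (hp.pos j)

theorem prod_q_pos (hp : IsBirthDeath p) (i : ℕ) : 0 < ∏ j ∈ Finset.Icc 1 i, (1 - p j) :=
  Finset.prod_pos fun j hj => (hp.2 j (Finset.mem_Icc.1 hj).1).2

theorem prod_p_pos (hp : IsBirthDeath p) (s : Finset ℕ) : 0 < ∏ j ∈ s, p j :=
  Finset.prod_pos fun j _ => hp.pos j

theorem _root_.bdScale_zero (p : ℕ → ℝ) : bdScale p 0 = 1 := by simp [bdScale]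

theorem bdScale_succ (p : ℕ → ℝ) (k : ℕ) :
    bdScale p (k + 1) = bdScale p k * ((1 - p (k + 1)) / p (k + 1)) := by
  unfold bdScale
  rw [Finset.prod_Icc_succ_top (by omega)]

theorem scaleE_zero (p : ℕ → ℝ) : scaleE p 0 = 1 := by simp [scaleE, bdScale_zero]

theorem scaleE_ne_zero (hp : IsBirthDeath p) (k : ℕ) : scaleE p k ≠ 0 := by
  simpa [scaleE] using hp.bdScale_pos k

theorem scaleE_ne_top (p : ℕ → ℝ) (k : ℕ) : scaleE p k ≠ ⊤ := ENNReal.ofReal_ne_top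

theorem speedDensity_zero (p : ℕ → ℝ) : speedDensity p 0 = 1 := by simp [speedDensity]

/-- Detailed balance of the scale. -/
theorem ofReal_mul_scaleE_succ (hp : IsBirthDeath p) (i : ℕ) :
    ENNReal.ofReal (p (i + 1)) * scaleE p (i + 1) =
      ENNReal.ofReal (1 - p (i + 1)) * scaleE p i := by
  unfold scaleE
  rw [← ENNReal.ofReal_mul (hp.pos _).le, ← ENNReal.ofReal_mul (hp.nonneg _), bdScale_succ]
  congr 1
  have := (hp.pos (i + 1)).ne'
  field_simp

/-- The products telescope. With detailed balance and p + q = 1, this is all that the later algebra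
needs to know about `p`. -/
theorem ofReal_mul_scaleE_mul_speedDensity (hp : IsBirthDeath p) (i : ℕ) :
    ENNReal.ofReal (p i) * scaleE p i * speedDensity p i = 1 := by
  unfold scaleE speedDensity
  rw [← ENNReal.ofReal_mul (hp.pos _).le,
    ← ENNReal.ofReal_mul (mul_pos (hp.pos _) (hp.bdScale_pos i)).le, ← ENNReal.ofReal_one]
  congr 1
  have h1 := (hp.prod_q_pos i).ne'
  unfold bdScale
  rw [Finset.prod_div_distrib]
  have h2 := (hp.prod_p_pos (Finset.Icc 1 i)).ne'
  rcases Nat.eq_zero_or_pos i with rfl | hi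
  · simp [hp.1]
  · have h3 : ∏ j ∈ Finset.Icc 1 i, p j = (∏ j ∈ Finset.Ico 1 i, p j) * p i := by
      obtain ⟨m, rfl⟩ : ∃ m, i = m + 1 := ⟨i - 1, by omega⟩
      rw [Finset.prod_Icc_succ_top (by omega)]
      rfl
    rw [h3] at h2 ⊢
    have h4 := left_ne_zero_of_mul h2
    have h5 := right_ne_zero_of_mul h2
    field_simp

section Balance

variable {R : Type*} [CommSemiring R] {P Q a b ρ : R}

/-- In this section P, Q are the jump probabilities at i + 1, while a = δ_i, b = δ_{i+1} and ρ is
the speed density at i + 1. The identities are subtraction-free, so they apply in `ℝ≥0∞` even to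
infinite values. -/
theorem balance_up (h1 : P * b = Q * a) (h2 : P * b * ρ = 1) (h3 : P + Q = 1) (w S H : R) :
    w + (P * H + Q * (a * S + (b * (S + w * ρ) + H))) = b * (S + w * ρ) + H := by
  calc _ = (P * b * ρ) * w + (P + Q) * H + (Q * a) * S + Q * b * (S + w * ρ) := by rw [h2]; ring
    _ = (P + Q) * (b * (S + w * ρ) + H) := by rw [← h1]; ring
    _ = _ := by rw [h3, one_mul]

theorem balance_up_sum (h1 : P * b = Q * a) (h2 : P * b * ρ = 1) (h3 : P + Q = 1) (w S f : R) :
    P * (f + a * S + b * (S + w * ρ)) + Q * f = f + a * S + w := by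
  calc _ = (P + Q) * f + P * a * S + (P * b) * S + (P * b * ρ) * w := by ring
    _ = (P + Q) * (f + a * S) + (P * b * ρ) * w := by rw [h1]; ring
    _ = _ := by rw [h3, h2, one_mul, one_mul]

theorem balance_down (h1 : P * b = Q * a) (h2 : P * b * ρ = 1) (h3 : P + Q = 1) (w T f : R) :
    w + (P * (f + a * (w * ρ + T) + b * T) + Q * f) = f + a * (w * ρ + T) := by
  calc _ = (P * b * ρ) * w + (P + Q) * f + P * a * (w * ρ + T) + (P * b) * T := by rw [h2]; ring
    _ = (P + Q) * (f + a * (w * ρ + T)) := by rw [h1]; ring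
    _ = _ := by rw [h3, one_mul]

theorem balance_down_sum (h1 : P * b = Q * a) (h3 : P + Q = 1) (S T f : R) :
    P * f + Q * (f + b * T + a * S) = f + Q * b * T + P * b * S := by
  calc _ = (P + Q) * f + Q * b * T + (Q * a) * S := by ring
    _ = _ := by rw [h3, ← h1, one_mul]

end Balance

variable (w : ℕ → ℝ≥0∞)

/-- The mean cost up to explosion solves the Poisson equation. -/
theorem poisson_explosion (hp : IsBirthDeath p) (i : ℕ) :
    w i + bdOp p (fun i => ∑' k, scaleE p (i + k) *
      ∑ j ∈ Finset.range (i + k + 1), w j * speedDensity p j) i =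
    ∑' k, scaleE p (i + k) * ∑ j ∈ Finset.range (i + k + 1), w j * speedDensity p j := by
  set h : ℕ → ℝ≥0∞ := fun i => ∑' k, scaleE p (i + k) *
      ∑ j ∈ Finset.range (i + k + 1), w j * speedDensity p j with hh
  have hrec : ∀ i, h i =
      scaleE p i * (∑ j ∈ Finset.range (i + 1), w j * speedDensity p j) + h (i + 1) := by
    intro i
    simp only [hh]
    rw [tsum_eq_zero_add' ENNReal.summable]
    simp [add_assoc, add_comm 1]
  change w i + bdOp p h i = h i
  rcases i with _ | m
  · rw [hrec 0]
    simp [bdOp, hp.1, scaleE_zero, speedDensity_zero]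
  · have h1 := hp.ofReal_mul_scaleE_succ m
    have h2 := hp.ofReal_mul_scaleE_mul_speedDensity (m + 1)
    have h3 := hp.ofReal_add (m + 1)
    unfold bdOp
    rw [hrec (m + 1), Nat.add_sub_cancel, hrec m, hrec (m + 1), Finset.sum_range_succ _ (m + 1)]
    exact balance_up h1 h2 h3 _ _ _

/-- The increments of this function are the terms of the explosion series, so it tends to infinity
exactly when that series diverges. Its excess under the transition operator is the `w i` that
discounting absorbs. -/
theorem bdOp_explosion (hp : IsBirthDeath p) (i : ℕ) :
    bdOp p (fun i => 1 + ∑ k ∈ Finset.range i, scaleE p k *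
      ∑ j ∈ Finset.range (k + 1), w j * speedDensity p j) i =
    1 + ∑ k ∈ Finset.range i, scaleE p k *
      (∑ j ∈ Finset.range (k + 1), w j * speedDensity p j) + w i := by
  unfold bdOp
  rcases i with _ | m
  · simp [hp.1, scaleE_zero, speedDensity_zero]
  · have h1 := hp.ofReal_mul_scaleE_succ m
    have h2 := hp.ofReal_mul_scaleE_mul_speedDensity (m + 1)
    have h3 := hp.ofReal_add (m + 1)
    beta_reduce
    rw [Nat.add_sub_cancel, Finset.sum_range_succ _ (m + 1), Finset.sum_range_succ _ m,
      Finset.sum_range_succ _ (m + 1), ← add_assoc, ← add_assoc]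
    exact balance_up_sum h1 h2 h3 _ _ _

/-- The mean cost up to hitting `0` solves the Poisson equation. -/
theorem poisson_implosion (hp : IsBirthDeath p) (i : ℕ) :
    w (i + 1) + bdOp p (fun i => ∑ k ∈ Finset.range i, scaleE p k *
      ∑' j, w (k + 1 + j) * speedDensity p (k + 1 + j)) (i + 1) =
    ∑ k ∈ Finset.range (i + 1), scaleE p k *
      ∑' j, w (k + 1 + j) * speedDensity p (k + 1 + j) := by
  have hrec : ∑' j, w (i + 1 + j) * speedDensity p (i + 1 + j) = w (i + 1) * speedDensity p (i + 1)
      + ∑' j, w (i + 1 + 1 + j) * speedDensity p (i + 1 + 1 + j) := by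
    rw [tsum_eq_zero_add' ENNReal.summable]
    simp only [add_zero, add_assoc, add_comm 1]
  have h1 := hp.ofReal_mul_scaleE_succ i
  have h2 := hp.ofReal_mul_scaleE_mul_speedDensity (i + 1)
  have h3 := hp.ofReal_add (i + 1)
  unfold bdOp
  beta_reduce
  rw [Nat.add_sub_cancel, Finset.sum_range_succ _ (i + 1), Finset.sum_range_succ _ i, hrec]
  exact balance_down h1 h2 h3 _ _ _

/-- Truncating at `n` keeps the tails of the speed series finite for finite `w` and makes the
barrier equal to 1 from `n` on. Sources above `n` are lost, hence an inequality. -/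
theorem bdOp_implosion (hp : IsBirthDeath p) (n i : ℕ) :
    bdOp p (fun i => 1 + ∑ k ∈ Finset.Ico i n, scaleE p k *
      ∑ j ∈ Finset.Ioc k n, w j * speedDensity p j) (i + 1) ≤
    1 + ∑ k ∈ Finset.Ico (i + 1) n, scaleE p k *
      (∑ j ∈ Finset.Ioc k n, w j * speedDensity p j) + w (i + 1) := by
  set T : ℕ → ℝ≥0∞ := fun k => ∑ j ∈ Finset.Ioc k n, w j * speedDensity p j with hT
  have hT0 : ∀ k, n ≤ k → T k = 0 := fun k hk => by simp [hT, Finset.Ioc_eq_empty_of_le hk]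
  have hTs : T i ≤ T (i + 1) + w (i + 1) * speedDensity p (i + 1) := by
    rcases Nat.lt_or_ge i n with hi | hi
    · refine le_of_eq ?_
      simp only [hT]
      rw [Finset.sum_Ioc_add_eq_sum_Icc (f := fun j => w j * speedDensity p j)
        (Nat.succ_le_of_lt hi)]
      exact Finset.sum_congr (by ext j; simp) fun _ _ => rfl
    · rw [hT0 i hi]
      exact zero_le
  set f : ℕ → ℝ≥0∞ := fun i => 1 + ∑ k ∈ Finset.Ico i n, scaleE p k * T k with hf
  have hrec : ∀ i, f i = f (i + 1) + scaleE p i * T i := by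
    intro i
    simp only [hf]
    rcases Nat.lt_or_ge i n with hi | hi
    · rw [Finset.sum_eq_sum_Ico_succ_bot hi]
      ring
    · simp [hT0 i hi, Finset.Ico_eq_empty_of_le hi, Finset.Ico_eq_empty_of_le (hi.trans i.le_succ)]
  have h1 := hp.ofReal_mul_scaleE_succ i
  have h2 := hp.ofReal_mul_scaleE_mul_speedDensity (i + 1)
  have h3 := hp.ofReal_add (i + 1)
  change bdOp p f (i + 1) ≤ f (i + 1) + w (i + 1)
  unfold bdOp
  rw [Nat.add_sub_cancel, hrec i, hrec (i + 1)]
  set P := ENNReal.ofReal (p (i + 1))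
  set Q := ENNReal.ofReal (1 - p (i + 1))
  calc _ = f (i + 2) + Q * scaleE p (i + 1) * T (i + 1) + P * scaleE p (i + 1) * T i :=
        balance_down_sum h1 h3 _ _ _
    _ ≤ f (i + 2) + Q * scaleE p (i + 1) * T (i + 1) + P * scaleE p (i + 1) *
        (T (i + 1) + w (i + 1) * speedDensity p (i + 1)) := by gcongr
    _ = f (i + 2) + (P + Q) * (scaleE p (i + 1) * T (i + 1)) +
        P * scaleE p (i + 1) * speedDensity p (i + 1) * w (i + 1) := by ring
    _ = _ := by rw [h2, h3, one_mul, one_mul]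

/-- Harmonicity off 0 of the scale function, which is a Lyapunov function for reaching 0 when Σ δ_k
diverges. -/
theorem bdOp_scale (hp : IsBirthDeath p) (i : ℕ) :
    bdOp p (fun i => ∑ k ∈ Finset.range i, scaleE p k) (i + 1) =
      ∑ k ∈ Finset.range (i + 1), scaleE p k := by
  have h1 := hp.ofReal_mul_scaleE_succ i
  have h3 := hp.ofReal_add (i + 1)
  unfold bdOp
  beta_reduce
  rw [Nat.add_sub_cancel, Finset.sum_range_succ _ (i + 1), Finset.sum_range_succ _ i]
  calc _ = (ENNReal.ofReal (p (i + 1)) + ENNReal.ofReal (1 - p (i + 1))) *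
        ∑ k ∈ Finset.range i, scaleE p k + ENNReal.ofReal (p (i + 1)) * scaleE p i +
        ENNReal.ofReal (p (i + 1)) * scaleE p (i + 1) := by ring
    _ = (ENNReal.ofReal (p (i + 1)) + ENNReal.ofReal (1 - p (i + 1))) *
        (∑ k ∈ Finset.range i, scaleE p k + scaleE p i) := by rw [h1]; ring
    _ = _ := by rw [h3, one_mul]

/-- When Σ δ_k converges this harmonic function tends to 0 at infinity; it is the barrier in the
transient case. -/
theorem bdOp_scale_tail (hp : IsBirthDeath p) (i : ℕ) :
    bdOp p (fun i => ∑' k, scaleE p (i + k)) (i + 1) = ∑' k, scaleE p (i + 1 + k) := by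
  have h1 := hp.ofReal_mul_scaleE_succ i
  have h3 := hp.ofReal_add (i + 1)
  have hrec : ∀ i, ∑' k, scaleE p (i + k) = scaleE p i + ∑' k, scaleE p (i + 1 + k) := by
    intro i
    rw [tsum_eq_zero_add' ENNReal.summable]
    simp [add_assoc, add_comm 1]
  unfold bdOp
  beta_reduce
  rw [Nat.add_sub_cancel, hrec i, hrec (i + 1)]
  set H := ∑' k, scaleE p (i + 1 + 1 + k)
  set P := ENNReal.ofReal (p (i + 1))
  set Q := ENNReal.ofReal (1 - p (i + 1))
  calc _ = (P + Q) * H + Q * scaleE p (i + 1) + Q * scaleE p i := by ring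
    _ = (P + Q) * (scaleE p (i + 1) + H) := by rw [← h1]; ring
    _ = _ := by rw [h3, one_mul]

end IsBirthDeath

/-! ### The bounded cost and discounted superharmonicity. -/

/-- The cost `1 - exp (-t)` of a waiting time. -/
noncomputable def expCost (t : ℝ) : ℝ≥0∞ := ENNReal.ofReal (1 - Real.exp (-t))

theorem measurable_expCost : Measurable expCost :=
  (measurable_const.sub (Real.measurable_exp.comp measurable_neg)).ennreal_ofReal

theorem lintegral_exp_add_expCost {m : Measure ℝ} [IsProbabilityMeasure m]
    (hm : ∀ᵐ t ∂m, 0 < t) :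
    ∫⁻ t, ENNReal.ofReal (Real.exp (-t)) ∂m + ∫⁻ t, expCost t ∂m = 1 := by
  rw [← lintegral_add_right _ measurable_expCost]
  calc _ = ∫⁻ _, 1 ∂m := by
        refine lintegral_congr_ae ?_
        filter_upwards [hm] with t ht
        unfold expCost
        rw [← ENNReal.ofReal_add (Real.exp_pos _).le (by simpa using ht.le)]
        simp
    _ = 1 := by simp

section

variable {p : ℕ → ℝ} {F : Dir → ℕ → Measure ℝ}

theorem laplaceOp_le_bdOp [∀ d i, IsProbabilityMeasure (F d i)]
    (hpos : ∀ d i, ∀ᵐ t ∂F d i, 0 < t) (f : ℕ → ℝ≥0∞) (i : ℕ) : laplaceOp p F f i ≤ bdOp p f i := by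
  have h : ∀ d, ∫⁻ t, ENNReal.ofReal (Real.exp (-t)) ∂F d i ≤ 1 := fun d =>
    le_self_add.trans (lintegral_exp_add_expCost (hpos d i)).le
  unfold laplaceOp bdOp
  gcongr
  · exact mul_le_of_le_one_left' (h _)
  · exact mul_le_of_le_one_left' (h _)

theorem waitMean_le_one (hp : IsBirthDeath p) [∀ d i, IsProbabilityMeasure (F d i)]
    (hpos : ∀ d i, ∀ᵐ t ∂F d i, 0 < t) (i : ℕ) : waitMean p F expCost i ≤ 1 := by
  have h : ∀ d, ∫⁻ t, expCost t ∂F d i ≤ 1 := fun d =>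
    le_add_self.trans (lintegral_exp_add_expCost (hpos d i)).le
  rw [← hp.ofReal_add i]
  unfold waitMean
  gcongr
  · exact mul_le_of_le_one_right' (h _)
  · exact mul_le_of_le_one_right' (h _)

/-- A criterion for discounted superharmonicity. -/
theorem laplaceOp_le_of_bdOp_le (hp : IsBirthDeath p) [∀ d i, IsProbabilityMeasure (F d i)]
    (hpos : ∀ d i, ∀ᵐ t ∂F d i, 0 < t) {f : ℕ → ℝ≥0∞} (hf : ∀ i, 1 ≤ f i) {i : ℕ}
    (hi : bdOp p f i ≤ f i + waitMean p F expCost i) : laplaceOp p F f i ≤ f i := by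
  have hfin : waitMean p F expCost i ≠ ⊤ :=
    ((waitMean_le_one hp hpos i).trans_lt ENNReal.one_lt_top).ne
  rw [← ENNReal.add_le_add_iff_right hfin]
  refine le_trans ?_ hi
  have h1 := lintegral_exp_add_expCost (hpos Dir.right i)
  have h2 := lintegral_exp_add_expCost (hpos Dir.left i)
  -- What discounting removes is the second summand, where values of `f` are weighted by mean costs.
  -- As `f ≥ 1`, it is at least `waitMean p F expCost i`.
  have key : bdOp p f i = laplaceOp p F f i + (ENNReal.ofReal (p i) *
      ((∫⁻ t, expCost t ∂F Dir.right i) * f (i + 1)) + ENNReal.ofReal (1 - p i) *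
      ((∫⁻ t, expCost t ∂F Dir.left i) * f (i - 1))) := by
    unfold bdOp laplaceOp
    calc _ = ENNReal.ofReal (p i) * ((∫⁻ t, ENNReal.ofReal (Real.exp (-t)) ∂F Dir.right i +
          ∫⁻ t, expCost t ∂F Dir.right i) * f (i + 1)) + ENNReal.ofReal (1 - p i) *
          ((∫⁻ t, ENNReal.ofReal (Real.exp (-t)) ∂F Dir.left i +
          ∫⁻ t, expCost t ∂F Dir.left i) * f (i - 1)) := by rw [h1, h2, one_mul, one_mul]
      _ = _ := by ring
  rw [key]
  unfold waitMean
  gcongr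
  · exact le_mul_of_one_le_right' (hf _)
  · exact le_mul_of_one_le_right' (hf _)

theorem sojournLaplace_eq (hp : IsBirthDeath p) [∀ d i, IsProbabilityMeasure (F d i)]
    (hpos : ∀ d i, ∀ᵐ t ∂F d i, 0 < t) (i : ℕ) :
    ENNReal.ofReal (1 - sojournLaplace p F i) = waitMean p F expCost i := by
  have hint : ∀ d, Integrable (fun t => Real.exp (-t)) (F d i) := fun d => by
    refine Integrable.of_bound (Real.measurable_exp.comp measurable_neg).aestronglyMeasurable 1 ?_
    filter_upwards [hpos d i] with t ht
    simpa using ht.le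
  have hE : ∀ d, ∫⁻ t, expCost t ∂F d i = ENNReal.ofReal (1 - ∫ t, Real.exp (-t) ∂F d i) := by
    intro d
    unfold expCost
    rw [← ofReal_integral_eq_lintegral_ofReal (f := fun t => 1 - Real.exp (-t))
      ((integrable_const 1).sub (hint d)), integral_sub (integrable_const 1) (hint d)]
    · simp
    · filter_upwards [hpos d i] with t ht
      simpa using ht.le
  have hle : ∀ d, ∫ t, Real.exp (-t) ∂F d i ≤ 1 := fun d => by
    calc _ ≤ ∫ _, (1 : ℝ) ∂F d i := by
          refine integral_mono_ae (hint d) (integrable_const 1) ?_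
          filter_upwards [hpos d i] with t ht
          simpa using ht.le
      _ = 1 := by simp
  unfold waitMean sojournLaplace
  rw [hE, hE, ← ENNReal.ofReal_mul (hp.pos i).le, ← ENNReal.ofReal_mul (hp.nonneg i),
    ← ENNReal.ofReal_add (mul_nonneg (hp.pos i).le (sub_nonneg.2 (hle _)))
      (mul_nonneg (hp.nonneg i) (sub_nonneg.2 (hle _)))]
  congr 1
  ring

theorem ofReal_bdSpeed (hp : IsBirthDeath p) [∀ d i, IsProbabilityMeasure (F d i)]
    (hpos : ∀ d i, ∀ᵐ t ∂F d i, 0 < t) (i : ℕ) :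
    ENNReal.ofReal (bdSpeed p F i) = waitMean p F expCost i * speedDensity p i := by
  unfold bdSpeed speedDensity
  rw [ENNReal.ofReal_mul', sojournLaplace_eq hp hpos]
  exact (div_pos (hp.prod_p_pos _) (hp.prod_q_pos i)).le

theorem lintegral_expCost_pos {m : Measure ℝ} [IsProbabilityMeasure m] (hm : ∀ᵐ t ∂m, 0 < t) :
    0 < ∫⁻ t, expCost t ∂m := by
  rw [pos_iff_ne_zero, Ne, lintegral_eq_zero_iff measurable_expCost]
  intro h
  have : ∀ᵐ _ ∂m, False := by
    filter_upwards [h, hm] with t h1 h2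
    simp only [expCost, Pi.zero_apply, ENNReal.ofReal_eq_zero, sub_nonpos,
      Real.one_le_exp_iff] at h1
    linarith
  exact this.exists.elim fun _ h => h

theorem waitMean_expCost_pos (hp : IsBirthDeath p) [∀ d i, IsProbabilityMeasure (F d i)]
    (hpos : ∀ d i, ∀ᵐ t ∂F d i, 0 < t) (i : ℕ) : 0 < waitMean p F expCost i := by
  unfold waitMean
  refine lt_of_lt_of_le ?_ le_self_add
  exact ENNReal.mul_pos (by simpa using hp.pos i) (lintegral_expCost_pos (hpos _ _)).ne'

end

/-! ### Deterministic facts about single paths. -/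

section Paths

variable {Ω : Type*} {X : ℕ → Ω → ℕ} {τ : Dir → ℕ → ℕ → Ω → ℝ} {ω : Ω}

theorem jumpTime_strictMono (hs : ∀ k, 0 < sojourn X τ k ω) :
    StrictMono fun k => jumpTime X τ k ω := by
  refine strictMono_nat_of_lt_succ fun k => ?_
  unfold jumpTime
  rw [Finset.sum_range_succ]
  linarith [hs k]

theorem jumpTime_nonneg (hs : ∀ k, 0 < sojourn X τ k ω) (k : ℕ) : 0 ≤ jumpTime X τ k ω :=
  Finset.sum_nonneg fun j _ => (hs j).le

/-- Positive sojourns make [T_k, T_{k+1}) nonempty, so the walk is at `X k` at time T_k itself. -/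
theorem hittingTime_le (hs : ∀ k, 0 < sojourn X τ k ω) {k n : ℕ} (hk : X k ω = n) :
    hittingTime X τ n ω ≤ ENNReal.ofReal (jumpTime X τ k ω) := by
  refine iInf₂_le (jumpTime X τ k ω).toNNReal ⟨k, ?_, ?_, hk⟩
  · rw [Real.coe_toNNReal _ (jumpTime_nonneg hs k)]
  · rw [Real.coe_toNNReal _ (jumpTime_nonneg hs k)]
    exact jumpTime_strictMono hs (Nat.lt_succ_self k)

theorem exists_of_hittingTime_lt {n : ℕ} {c : ℝ≥0∞} (h : hittingTime X τ n ω < c) :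
    ∃ k, X k ω = n ∧ ENNReal.ofReal (jumpTime X τ k ω) < c := by
  simp only [hittingTime, iInf_lt_iff] at h
  obtain ⟨t, ⟨k, hk1, -, hk⟩, ht⟩ := h
  refine ⟨k, hk, lt_of_le_of_lt ?_ ht⟩
  rw [← ENNReal.ofReal_coe_nnreal]
  exact ENNReal.ofReal_le_ofReal hk1

/-- Discrete intermediate value property: upward steps have size one. -/
theorem exists_visit (hn : ∀ k, X (k + 1) ω = X k ω + 1 ∨ X k ω = X (k + 1) ω + 1) {n k : ℕ}
    (h0 : X 0 ω ≤ n) (hk : n ≤ X k ω) : ∃ j ≤ k, X j ω = n := by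
  induction k with
  | zero => exact ⟨0, le_rfl, le_antisymm h0 hk⟩
  | succ k ih =>
    rcases Nat.lt_or_ge (X k ω) n with h | h
    · refine ⟨k + 1, le_rfl, ?_⟩
      rcases hn k with h1 | h1 <;> omega
    · obtain ⟨j, hj, hjn⟩ := ih h
      exact ⟨j, by omega, hjn⟩

theorem hittingTime_le_succ (hs : ∀ k, 0 < sojourn X τ k ω)
    (hn : ∀ k, X (k + 1) ω = X k ω + 1 ∨ X k ω = X (k + 1) ω + 1) {n : ℕ} (h0 : X 0 ω ≤ n) :
    hittingTime X τ n ω ≤ hittingTime X τ (n + 1) ω := by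
  refine le_of_forall_gt fun c hc => ?_
  obtain ⟨k, hk, hkc⟩ := exists_of_hittingTime_lt hc
  obtain ⟨j, hj, hjn⟩ := exists_visit hn h0 (by omega : n ≤ X k ω)
  refine ((hittingTime_le hs hjn).trans ?_).trans_lt hkc
  exact ENNReal.ofReal_le_ofReal ((jumpTime_strictMono hs).monotone hj)

/-- Levels above the start are hit in increasing order, all before the finite total time. Below `X
0` monotonicity may fail, hence the shift of the index by `X 0 ω`. -/
theorem mem_explosionEvent (hs : ∀ k, 0 < sojourn X τ k ω)
    (hn : ∀ k, X (k + 1) ω = X k ω + 1 ∨ X k ω = X (k + 1) ω + 1)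
    (hX : Tendsto (fun k => X k ω) atTop atTop) (hT : Summable fun k => sojourn X τ k ω) :
    ω ∈ explosionEvent X τ := by
  have hmono : Monotone fun n => hittingTime X τ (n + X 0 ω) ω :=
    monotone_nat_of_le_succ fun n => by
      have := hittingTime_le_succ hs hn (n := n + X 0 ω) (by omega)
      rwa [add_right_comm] at this
  have hlim := tendsto_atTop_iSup hmono
  have hbdd : ⨆ n, hittingTime X τ (n + X 0 ω) ω ≤ ENNReal.ofReal (∑' k, sojourn X τ k ω) := by
    refine iSup_le fun n => ?_
    obtain ⟨k, hk⟩ := (hX.eventually_ge_atTop (n + X 0 ω)).exists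
    obtain ⟨j, -, hj⟩ := exists_visit hn (n := n + X 0 ω) (by omega) hk
    refine (hittingTime_le hs hj).trans (ENNReal.ofReal_le_ofReal ?_)
    exact hT.sum_le_tsum _ fun i _ => (hs i).le
  refine ⟨(⨆ n, hittingTime X τ (n + X 0 ω) ω).toNNReal, ?_⟩
  rw [ENNReal.coe_toNNReal (hbdd.trans_lt ENNReal.ofReal_lt_top).ne]
  exact (tendsto_add_atTop_iff_nat (f := fun n => hittingTime X τ n ω) (X 0 ω)).1 hlim

/-- One bound serves every `n`: some level N ≥ n is hit before `C`, and the first entrance into [n,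
∞) is no later. -/
theorem exists_bound_of_mem_explosionEvent (hs : ∀ k, 0 < sojourn X τ k ω)
    (h : ω ∈ explosionEvent X τ) : ∃ C : ℕ, ∀ n, ∃ m, X m ω ∈ Set.Ici n ∧
      (∀ j < m, X j ω ∉ Set.Ici n) ∧ jumpTime X τ m ω ≤ C := by
  classical
  obtain ⟨s, hlim⟩ := h
  obtain ⟨C, hC⟩ := exists_nat_gt s
  refine ⟨C, fun n => ?_⟩
  have hC' : (s : ℝ≥0∞) < ((C : ℝ≥0) : ℝ≥0∞) := by exact_mod_cast hC
  obtain ⟨N, hNn, hN⟩ := ((eventually_ge_atTop n).and (hlim.eventually_lt_const hC')).exists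
  obtain ⟨k, hk, hkC⟩ := exists_of_hittingTime_lt hN
  have hex : ∃ m, X m ω ∈ Set.Ici n := ⟨k, by simpa [hk] using hNn⟩
  refine ⟨Nat.find hex, Nat.find_spec hex, fun j hj => Nat.find_min hex hj, ?_⟩
  have h1 : Nat.find hex ≤ k := Nat.find_min' hex (by simpa [hk] using hNn)
  refine ((jumpTime_strictMono hs).monotone h1).trans ?_
  rw [← ENNReal.ofReal_coe_nnreal] at hkC
  have := (ENNReal.ofReal_lt_ofReal_iff_of_nonneg (jumpTime_nonneg hs k)).1 hkC
  simpa using this.le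

/-- A path with finite cost leaves every finite set of states. -/
theorem tendsto_of_tsum_ne_top {w : ℕ → ℝ≥0∞} (hw : ∀ i, w i ≠ 0) {x : ℕ → ℕ}
    (h : ∑' k, w (x k) ≠ ⊤) : Tendsto x atTop atTop := by
  rw [tendsto_atTop]
  intro n
  have h0 := ENNReal.tendsto_atTop_zero_of_tsum_ne_top h
  have hne : (Finset.range (n + 1)).Nonempty := ⟨0, by simp⟩
  have hpos : 0 < (Finset.range (n + 1)).inf' hne w :=
    (Finset.lt_inf'_iff hne).2 fun i _ => pos_iff_ne_zero.2 (hw i)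
  filter_upwards [h0.eventually_lt_const hpos] with k hk
  by_contra hlt
  exact absurd (Finset.inf'_le w (Finset.mem_range.2 (by omega : x k < n + 1))) (not_le.2 hk)

/-- If the truncated waiting times are summable, so are the waiting times. -/
theorem summable_of_tsum_expCost_ne_top {s : ℕ → ℝ} (hs : ∀ k, 0 < s k)
    (h : ∑' k, expCost (s k) ≠ ⊤) : Summable s := by
  have hnn : ∀ k, 0 ≤ 1 - Real.exp (-s k) := fun k => by simpa using (hs k).le
  have hsum : Summable fun k => 1 - Real.exp (-s k) := by
    have := ENNReal.summable_toReal h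
    simpa only [expCost, ENNReal.toReal_ofReal (hnn _)] using this
  have hbig := hsum.tendsto_atTop_zero.eventually_lt_const (by norm_num : (0 : ℝ) < 1 / 2)
  refine summable_of_isBigO_nat (hsum.mul_left 2) (Asymptotics.IsBigO.of_bound 1 ?_)
  filter_upwards [hbig] with k hk
  rw [Real.norm_of_nonneg (hs k).le, Real.norm_of_nonneg (by linarith [hnn k]), one_mul]
  have h1 := Real.exp_pos (-s k)
  have h2 := Real.add_one_le_exp (s k)
  have h3 : Real.exp (s k) * Real.exp (-s k) = 1 := by rw [← Real.exp_add]; simp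
  -- This is 1 + s ≤ e^s multiplied by e^{-s}. Since eventually e^{-s} > 1/2, it yields s ≤ 2(1 -
  -- e^{-s}).
  have h4 : s k * Real.exp (-s k) ≤ 1 - Real.exp (-s k) := by nlinarith
  nlinarith [hs k]

end Paths

/-! ### Explosion: the two alternatives. -/

namespace IsCTRW

variable {Ω : Type u} [MeasurableSpace Ω] {p : ℕ → ℝ} {F : Dir → ℕ → Measure ℝ}
  {X : ℕ → Ω → ℕ} {τ : Dir → ℕ → ℕ → Ω → ℝ} {μ : Measure Ω}

theorem ae_sojourn_pos (h : IsCTRW p F X τ μ) (hpos : ∀ d i, ∀ᵐ t ∂F d i, 0 < t) :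
    ∀ᵐ ω ∂μ, ∀ k, 0 < sojourn X τ k ω := by
  have : ∀ᵐ ω ∂μ, ∀ (i k : ℕ), 0 < τ Dir.right i k ω ∧ 0 < τ Dir.left i k ω := by
    rw [ae_all_iff]; intro i
    rw [ae_all_iff]; intro k
    have hd : ∀ d, ∀ᵐ ω ∂μ, 0 < τ d i k ω := fun d => by
      have := hpos d i
      rw [← h.law_wait d i k] at this
      exact ae_of_ae_map (h.measurable_wait d i k).aemeasurable this
    exact (hd _).and (hd _)
  filter_upwards [this] with ω hω k
  unfold sojourn
  split_ifs
  exacts [(hω _ _).1, (hω _ _).2]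

/-- Charge 1 for every jump to a non-neighbour: the mean charge per step is 0, so it is almost
surely never paid. -/
theorem ae_neighbor (h : IsCTRW p F X τ μ) (hp : IsBirthDeath p) :
    ∀ᵐ ω ∂μ, ∀ k, X (k + 1) ω = X k ω + 1 ∨ X k ω = X (k + 1) ω + 1 := by
  classical
  rw [ae_all_iff]
  intro k
  let ψ : ℕ → ℕ → ℝ → ℝ≥0∞ := fun i j _ => if j = i + 1 ∨ i = j + 1 then 0 else 1
  have key := h.lintegral_step hp k (G := fun _ _ => 1) (fun _ => measurable_const)
    (ψ := ψ) (fun _ _ => measurable_const)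
  have e : ∀ i, stepMean p F ψ i = 0 := by
    intro i
    rcases i with _ | i <;> simp [stepMean, ψ, hp.1]
  simp only [e, mul_zero, lintegral_zero, one_mul] at key
  have hm : Measurable fun ω => ψ (X k ω) (X (k + 1) ω) (sojourn X τ k ω) :=
    (measurable_of_countable fun z : ℕ × ℕ => ψ z.1 z.2 0).comp
      ((h.measurable_chain k).prodMk (h.measurable_chain (k + 1)))
  rw [lintegral_eq_zero_iff hm] at key
  filter_upwards [key] with ω hω
  by_contra hc
  simp [ψ, hc] at hω

/-- The general explosion series. -/
noncomputable def _root_.explosionSum (p : ℕ → ℝ) (F : Dir → ℕ → Measure ℝ) : ℝ≥0∞ :=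
  ∑' k, scaleE p k * ∑ j ∈ Finset.range (k + 1), waitMean p F expCost j * speedDensity p j

/-- The Poisson solution is bounded by the whole series, so any initial distribution is allowed.
With nothing killed, finite total cost makes the sojourns summable, and finite total mean cost sends
the chain to infinity. -/
theorem ae_mem_explosionEvent (h : IsCTRW p F X τ μ) (hp : IsBirthDeath p)
    (hpos : ∀ d i, ∀ᵐ t ∂F d i, 0 < t) (hE : explosionSum p F ≠ ⊤) :
    ∀ᵐ ω ∂μ, ω ∈ explosionEvent X τ := by
  have := h.isProbabilityMeasure
  have hF := h.isProbabilityMeasure_law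
  set g : ℕ → ℝ≥0∞ := fun i => ∑' k, scaleE p (i + k) *
      ∑ j ∈ Finset.range (i + k + 1), waitMean p F expCost j * speedDensity p j with hg
  have hgle : ∀ i, g i ≤ explosionSum p F := fun i =>
    ENNReal.tsum_comp_le_tsum_of_injective (add_right_injective i) fun k => scaleE p k *
      ∑ j ∈ Finset.range (k + 1), waitMean p F expCost j * speedDensity p j
  have hsup : ∀ i, i ∉ (∅ : Set ℕ) → waitMean p F expCost i + bdOp p g i ≤ g i :=
    fun i _ => (hp.poisson_explosion _ i).le
  have hfin : ∫⁻ ω, g (X 0 ω) ∂μ ≠ ⊤ := by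
    refine ne_top_of_le_ne_top hE ?_
    calc _ ≤ ∫⁻ _, explosionSum p F ∂μ := lintegral_mono fun ω => hgle _
      _ = _ := by simp
  have h1 := ae_lt_top (Measurable.tsum fun k =>
    h.measurable_aliveInd_mul_cost ∅ measurable_expCost k)
    (ne_top_of_le_ne_top hfin (h.lintegral_tsum_cost_le hp ∅ measurable_expCost hsup))
  have h2 := ae_lt_top (Measurable.tsum fun k =>
    h.measurable_aliveInd_mul_comp ∅ (waitMean p F expCost) (k + 1) k)
    (ne_top_of_le_ne_top hfin (h.lintegral_tsum_waitMean_le hp ∅ measurable_expCost hsup))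
  filter_upwards [h.ae_sojourn_pos hpos, h.ae_neighbor hp, h1, h2] with ω hs hn h1 h2
  have ha : ∀ n, aliveInd X ∅ n ω = 1 := fun n => aliveInd_of_forall fun _ _ => by simp
  simp only [ha, one_mul] at h1 h2
  exact mem_explosionEvent hs hn
    (tendsto_of_tsum_ne_top (fun i => (waitMean_expCost_pos hp hpos i).ne') h2.ne)
    (summable_of_tsum_expCost_ne_top hs h1.ne)

/-- Reaching [n, ∞) by time C from x has probability at most e^C f(x) / f(n), which tends to 0.
Countably many pairs (x, C) cover the explosion event. -/
theorem measure_explosionEvent_eq_zero (h : IsCTRW p F X τ μ) (hp : IsBirthDeath p)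
    (hpos : ∀ d i, ∀ᵐ t ∂F d i, 0 < t) (hE : explosionSum p F = ⊤) :
    μ (explosionEvent X τ) = 0 := by
  have hF := h.isProbabilityMeasure_law
  set f : ℕ → ℝ≥0∞ := fun i => 1 + ∑ k ∈ Finset.range i, scaleE p k *
      ∑ j ∈ Finset.range (k + 1), waitMean p F expCost j * speedDensity p j with hf
  have hf1 : ∀ i, 1 ≤ f i := fun i => le_self_add
  have hfsup : ∀ i, laplaceOp p F f i ≤ f i := fun i =>
    laplaceOp_le_of_bdOp_le hp hpos hf1 (hp.bdOp_explosion _ i).le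
  have hfmono : Monotone f := by
    refine monotone_nat_of_le_succ fun n => ?_
    simp only [hf]
    rw [Finset.sum_range_succ, ← add_assoc]
    exact le_self_add
  have hffin : ∀ i, f i ≠ ⊤ := fun i => by
    refine ENNReal.add_ne_top.2 ⟨ENNReal.one_ne_top, ENNReal.sum_ne_top.2 fun k _ =>
      ENNReal.mul_ne_top (IsBirthDeath.scaleE_ne_top p k) (ENNReal.sum_ne_top.2 fun j _ =>
        ENNReal.mul_ne_top ?_ ENNReal.ofReal_ne_top)⟩
    exact ((waitMean_le_one hp hpos j).trans_lt ENNReal.one_lt_top).ne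
  have hftop : Tendsto f atTop (𝓝 ⊤) := by
    have := (ENNReal.summable (f := fun k => scaleE p k * ∑ j ∈ Finset.range (k + 1),
      waitMean p F expCost j * speedDensity p j)).hasSum.tendsto_sum_nat.const_add 1
    rw [show ∑' k, _ = _ from hE, add_top] at this
    exact this
  have hnull : ∀ (x C : ℕ), μ {ω | X 0 ω = x ∧ ∀ n, ∃ m, X m ω ∈ Set.Ici n ∧
      (∀ j < m, X j ω ∉ Set.Ici n) ∧ jumpTime X τ m ω ≤ C} = 0 := by
    intro x C
    set A := {ω | X 0 ω = x ∧ ∀ n, ∃ m, X m ω ∈ Set.Ici n ∧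
      (∀ j < m, X j ω ∉ Set.Ici n) ∧ jumpTime X τ m ω ≤ C}
    by_contra hA
    have hbd : ∀ n, μ A * (ENNReal.ofReal (Real.exp (-(C : ℝ))) * f n) ≤ f x := by
      intro n
      refine le_trans ?_ (h.measure_hit_le hp (Set.Ici n) x C (fun i _ => hfsup i)
        fun i hi => hfmono hi)
      gcongr
      exact fun ω hω => ⟨hω.1, hω.2 n⟩
    have hexp : ENNReal.ofReal (Real.exp (-(C : ℝ))) ≠ 0 := by
      simpa using Real.exp_pos _
    -- If `μ A` were nonzero, these products would tend to infinity although each is at most the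
    -- finite value `f x`.
    have hlim : Tendsto (fun n => μ A * (ENNReal.ofReal (Real.exp (-(C : ℝ))) * f n)) atTop
        (𝓝 (μ A * (ENNReal.ofReal (Real.exp (-(C : ℝ))) * ⊤))) :=
      ENNReal.Tendsto.const_mul (ENNReal.Tendsto.const_mul hftop (Or.inl ENNReal.top_ne_zero))
        (Or.inl (by simp [ENNReal.mul_top hexp]))
    rw [ENNReal.mul_top hexp, ENNReal.mul_top hA] at hlim
    exact hffin x (top_le_iff.1 (le_of_tendsto' hlim hbd))
  have hae : ∀ᵐ ω ∂μ, ω ∉ explosionEvent X τ := by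
    have h1 : ∀ᵐ ω ∂μ, ∀ x C : ℕ, ¬ (X 0 ω = x ∧ ∀ n, ∃ m, X m ω ∈ Set.Ici n ∧
        (∀ j < m, X j ω ∉ Set.Ici n) ∧ jumpTime X τ m ω ≤ C) := by
      rw [ae_all_iff]; intro x
      rw [ae_all_iff]; intro C
      rw [ae_iff]
      simpa only [not_not] using hnull x C
    filter_upwards [h1, h.ae_sojourn_pos hpos] with ω h1 hs hω
    obtain ⟨C, hC⟩ := exists_bound_of_mem_explosionEvent hs hω
    exact h1 _ C ⟨rfl, hC⟩
  simpa [ae_iff] using hae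

end IsCTRW

/-! ### The implosion series and slowed costs. -/

/-- Tonelli on the triangle k ≤ i, grouping the pairs (k, j) by the antidiagonal k + j = i. -/
theorem ENNReal.tsum_tsum_add_eq_tsum_sum_range (A : ℕ → ℕ → ℝ≥0∞) :
    ∑' k, ∑' j, A k (k + j) = ∑' i, ∑ k ∈ Finset.range (i + 1), A k i := by
  rw [← ENNReal.tsum_prod (f := fun k j => A k (k + j)),
    ← Equiv.tsum_eq Finset.HasAntidiagonal.sigmaAntidiagonalEquivProd
      (fun z : ℕ × ℕ => A z.1 (z.1 + z.2)),
    ENNReal.tsum_sigma']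
  refine tsum_congr fun n => ?_
  rw [tsum_fintype]
  simp only [Finset.HasAntidiagonal.sigmaAntidiagonalEquivProd_apply]
  rw [Finset.sum_coe_sort (Finset.HasAntidiagonal.antidiagonal n) fun z => A z.1 (z.1 + z.2),
    Finset.Nat.sum_antidiagonal_eq_sum_range_succ_mk]
  refine Finset.sum_congr rfl fun k hk => ?_
  congr 1
  have := Finset.mem_range.1 hk
  omega

/-- The series `∑_k δ_k ∑_{i > k} ν_i`, with the cost `c` in place of `1 - exp (-t)`. -/
noncomputable def implosionSum (p : ℕ → ℝ) (F : Dir → ℕ → Measure ℝ) (c : ℝ → ℝ≥0∞) : ℝ≥0∞ :=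
  ∑' k, scaleE p k * ∑' j, waitMean p F c (k + 1 + j) * speedDensity p (k + 1 + j)

theorem implosionSum_eq (p : ℕ → ℝ) (F : Dir → ℕ → Measure ℝ) (c : ℝ → ℝ≥0∞) :
    implosionSum p F c = ∑' i, waitMean p F c (i + 1) *
      (speedDensity p (i + 1) * ∑ k ∈ Finset.range (i + 1), scaleE p k) := by
  unfold implosionSum
  simp only [← ENNReal.tsum_mul_left, add_right_comm _ 1]
  rw [ENNReal.tsum_tsum_add_eq_tsum_sum_range fun k i =>
    scaleE p k * (waitMean p F c (i + 1) * speedDensity p (i + 1))]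
  refine tsum_congr fun i => ?_
  rw [← Finset.sum_mul]
  ring

theorem expCost_mono {s t : ℝ} (h : s ≤ t) : expCost s ≤ expCost t :=
  ENNReal.ofReal_le_ofReal (by gcongr)

/-- Subadditivity of 1 - e^{-t}, which amounts to (1 - e^{-s})(1 - e^{-t}) ≥ 0. -/
theorem expCost_sum_le {s : ℕ → ℝ} (hs : ∀ k, 0 ≤ s k) (n : ℕ) :
    expCost (∑ k ∈ Finset.range n, s k) ≤ ∑ k ∈ Finset.range n, expCost (s k) := by
  induction n with
  | zero => simp [expCost]
  | succ n ih =>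
    rw [Finset.sum_range_succ, Finset.sum_range_succ]
    refine le_trans ?_ (add_le_add_left ih _)
    have h1 : 0 ≤ ∑ k ∈ Finset.range n, s k := Finset.sum_nonneg fun k _ => hs k
    unfold expCost
    rw [← ENNReal.ofReal_add (by simpa using h1) (by simpa using hs n)]
    refine ENNReal.ofReal_le_ofReal ?_
    rw [neg_add, Real.exp_add]
    have h2 : Real.exp (-∑ k ∈ Finset.range n, s k) ≤ 1 := by simpa using h1
    have h3 : Real.exp (-s n) ≤ 1 := by simpa using hs n
    nlinarith

/-- The cost `1 - exp (-t / C)`. -/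
noncomputable def slowCost (C : ℝ≥0) (t : ℝ) : ℝ≥0∞ := expCost (t / C)

theorem measurable_slowCost (C : ℝ≥0) : Measurable (slowCost C) :=
  measurable_expCost.comp (measurable_id.div_const _)

theorem slowCost_le {C : ℝ≥0} (hC : 1 ≤ C) {t : ℝ} (ht : 0 ≤ t) : slowCost C t ≤ expCost t :=
  expCost_mono (div_le_self ht (by exact_mod_cast hC))

theorem tendsto_slowCost (t : ℝ) : Tendsto (fun C => slowCost C t) atTop (𝓝 0) := by
  have h1 : Tendsto (fun C : ℝ≥0 => t / (C : ℝ)) atTop (𝓝 0) :=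
    tendsto_const_nhds.div_atTop (NNReal.tendsto_coe_atTop.2 tendsto_id)
  have h2 : Continuous expCost :=
    ENNReal.continuous_ofReal.comp (continuous_const.sub (Real.continuous_exp.comp continuous_neg))
  have := (h2.tendsto 0).comp h1
  simpa [expCost, slowCost, Function.comp_def] using this

section

variable {p : ℕ → ℝ} {F : Dir → ℕ → Measure ℝ}

theorem tendsto_lintegral_slowCost {m : Measure ℝ} [IsProbabilityMeasure m]
    (hm : ∀ᵐ t ∂m, 0 < t) : Tendsto (fun C => ∫⁻ t, slowCost C t ∂m) atTop (𝓝 0) := by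
  have := tendsto_lintegral_filter_of_dominated_convergence (μ := m) (l := (atTop : Filter ℝ≥0))
    (F := slowCost) (f := fun _ => 0) expCost (Eventually.of_forall measurable_slowCost)
    ?_ ?_ (ae_of_all _ tendsto_slowCost)
  · simpa using this
  · filter_upwards [eventually_ge_atTop 1] with C hC
    filter_upwards [hm] with t ht
    exact slowCost_le hC ht.le
  · refine ne_top_of_le_ne_top ENNReal.one_ne_top ?_
    rw [← lintegral_exp_add_expCost hm]
    exact le_add_self

theorem tendsto_waitMean_slowCost [∀ d i, IsProbabilityMeasure (F d i)]
    (hpos : ∀ d i, ∀ᵐ t ∂F d i, 0 < t) (i : ℕ) :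
    Tendsto (fun C => waitMean p F (slowCost C) i) atTop (𝓝 0) := by
  have h : ∀ d (a : ℝ), Tendsto (fun C => ENNReal.ofReal a * ∫⁻ t, slowCost C t ∂F d i) atTop
      (𝓝 0) := fun d a => by
    simpa using ENNReal.Tendsto.const_mul (tendsto_lintegral_slowCost (hpos d i))
      (Or.inr (ENNReal.ofReal_ne_top (r := a)))
  simpa [waitMean] using (h Dir.right (p i)).add (h Dir.left (1 - p i))

theorem waitMean_slowCost_le [∀ d i, IsProbabilityMeasure (F d i)]
    (hpos : ∀ d i, ∀ᵐ t ∂F d i, 0 < t) {C : ℝ≥0} (hC : 1 ≤ C) (i : ℕ) :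
    waitMean p F (slowCost C) i ≤ waitMean p F expCost i := by
  have h : ∀ d, ∫⁻ t, slowCost C t ∂F d i ≤ ∫⁻ t, expCost t ∂F d i := fun d => by
    refine lintegral_mono_ae ?_
    filter_upwards [hpos d i] with t ht
    exact slowCost_le hC ht.le
  exact add_le_add (mul_le_mul' le_rfl (h _)) (mul_le_mul' le_rfl (h _))

/-- Dominated convergence for the counting measure, with the series for `expCost` as the dominating
one. No starting state enters, which is the source of uniformity in implosion. -/
theorem tendsto_implosionSum_slowCost [∀ d i, IsProbabilityMeasure (F d i)]
    (hpos : ∀ d i, ∀ᵐ t ∂F d i, 0 < t) (hI : implosionSum p F expCost ≠ ⊤) :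
    Tendsto (fun C => implosionSum p F (slowCost C)) atTop (𝓝 0) := by
  simp only [implosionSum_eq, ← lintegral_count] at hI ⊢
  have := tendsto_lintegral_filter_of_dominated_convergence (μ := Measure.count)
    (l := (atTop : Filter ℝ≥0)) (F := fun C i => waitMean p F (slowCost C) (i + 1) *
      (speedDensity p (i + 1) * ∑ k ∈ Finset.range (i + 1), scaleE p k)) (f := fun _ => 0)
    _ (Eventually.of_forall fun C => measurable_of_countable _) ?_ hI ?_
  · simpa using this
  · filter_upwards [eventually_ge_atTop 1] with C hC
    refine ae_of_all _ fun i => ?_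
    gcongr
    exact waitMean_slowCost_le hpos hC _
  · refine ae_of_all _ fun i => ?_
    have := ENNReal.Tendsto.mul_const (b := speedDensity p (i + 1) *
      ∑ k ∈ Finset.range (i + 1), scaleE p k) (tendsto_waitMean_slowCost (p := p) hpos (i + 1))
      (Or.inr (ENNReal.mul_ne_top ENNReal.ofReal_ne_top
        (ENNReal.sum_ne_top.2 fun k _ => IsBirthDeath.scaleE_ne_top p k)))
    simpa using this

end

/-! ### Implosion: the two alternatives. -/

namespace IsCTRW

variable {Ω : Type u} [MeasurableSpace Ω] {p : ℕ → ℝ} {F : Dir → ℕ → Measure ℝ}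
  {X : ℕ → Ω → ℕ} {τ : Dir → ℕ → ℕ → Ω → ℝ} {μ : Measure Ω}

theorem lintegral_comp_start (h : IsCTRW p F X τ μ) {x : ℕ} (hx : ∀ᵐ ω ∂μ, X 0 ω = x)
    (f : ℕ → ℝ≥0∞) : ∫⁻ ω, f (X 0 ω) ∂μ = f x := by
  have := h.isProbabilityMeasure
  calc _ = ∫⁻ _, f x ∂μ := lintegral_congr_ae (by filter_upwards [hx] with ω hω; rw [hω])
    _ = f x := by simp

/-- The mean cost of the walk started at `i` before hitting `0`. -/
noncomputable def _root_.costToZero (p : ℕ → ℝ) (F : Dir → ℕ → Measure ℝ) (c : ℝ → ℝ≥0∞)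
    (i : ℕ) : ℝ≥0∞ :=
  ∑ k ∈ Finset.range i, scaleE p k *
    ∑' j, waitMean p F c (k + 1 + j) * speedDensity p (k + 1 + j)

theorem poisson_costToZero (hp : IsBirthDeath p) (c : ℝ → ℝ≥0∞) (i : ℕ)
    (hi : i ∉ ({0} : Set ℕ)) :
    waitMean p F c i + bdOp p (costToZero p F c) i ≤ costToZero p F c i := by
  obtain ⟨m, rfl⟩ := Nat.exists_eq_succ_of_ne_zero hi
  exact (hp.poisson_implosion _ m).le

theorem lintegral_costToZero_le (h : IsCTRW p F X τ μ) {x : ℕ} (hx : ∀ᵐ ω ∂μ, X 0 ω = x)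
    (c : ℝ → ℝ≥0∞) : ∫⁻ ω, costToZero p F c (X 0 ω) ∂μ ≤ implosionSum p F c :=
  (h.lintegral_comp_start hx _).trans_le (ENNReal.sum_le_tsum _)

/-- Under the implosion condition the walk hits `0`. -/
theorem ae_exists_zero (h : IsCTRW p F X τ μ) (hp : IsBirthDeath p)
    (hpos : ∀ d i, ∀ᵐ t ∂F d i, 0 < t) {x : ℕ} (hx : ∀ᵐ ω ∂μ, X 0 ω = x)
    (hI : implosionSum p F expCost ≠ ⊤) (hδ : ∑' k, scaleE p k = ⊤) :
    ∀ᵐ ω ∂μ, ∃ m, X m ω = 0 := by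
  have hF := h.isProbabilityMeasure_law
  have h1 := ae_lt_top (Measurable.tsum fun k =>
    h.measurable_aliveInd_mul_comp {0} (waitMean p F expCost) (k + 1) k)
    (ne_top_of_le_ne_top hI ((h.lintegral_tsum_waitMean_le hp {0} measurable_expCost
      (poisson_costToZero hp _)).trans (h.lintegral_costToZero_le hx _)))
  -- `s` is harmonic off 0, so by Fatou the liminf of `s (X n)` is almost surely finite on paths
  -- avoiding 0. By `h1` such paths go to infinity, where `s` does too: a contradiction.
  set s : ℕ → ℝ≥0∞ := fun i => ∑ k ∈ Finset.range i, scaleE p k with hs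
  have hsx : s x ≠ ⊤ := ENNReal.sum_ne_top.2 fun k _ => IsBirthDeath.scaleE_ne_top p k
  have hsuper : ∀ i, i ∉ ({0} : Set ℕ) → waitMean p F 0 i + bdOp p s i ≤ s i := by
    intro i hi
    obtain ⟨m, rfl⟩ := Nat.exists_eq_succ_of_ne_zero hi
    rw [hp.bdOp_scale]
    simp [waitMean, hs]
  have hbd : ∀ n, ∫⁻ ω, aliveInd X {0} n ω * s (X n ω) ∂μ ≤ s x := fun n =>
    le_add_self.trans ((h.sum_cost_add_le hp {0} measurable_zero hsuper n).trans
      (h.lintegral_comp_start hx _).le)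
  have h2 := ae_lt_top (Measurable.liminf fun n => h.measurable_aliveInd_mul_comp {0} s n n)
    (ne_top_of_le_ne_top hsx ((lintegral_liminf_le
      fun n => h.measurable_aliveInd_mul_comp {0} s n n).trans
        ((liminf_le_liminf (Eventually.of_forall hbd)).trans (liminf_const (s x)).le)))
  have hs_lim : Tendsto s atTop (𝓝 ⊤) := by
    have := (ENNReal.summable (f := scaleE p)).hasSum.tendsto_sum_nat
    rwa [hδ] at this
  filter_upwards [h1, h2] with ω h1 h2
  by_contra! hne
  have ha : ∀ n, aliveInd X {0} n ω = 1 := fun n => aliveInd_of_forall fun j _ => hne j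
  simp only [ha, one_mul] at h1 h2
  have hX := tendsto_of_tsum_ne_top (fun i => (waitMean_expCost_pos hp hpos i).ne') h1.ne
  have h3 : Tendsto (fun k => s (X k ω)) atTop (𝓝 ⊤) := hs_lim.comp hX
  rw [h3.liminf_eq] at h2
  exact lt_irrefl _ h2

/-- Markov's inequality for the slowed cost before 0. If 0 is reached after `C`, the sojourns
divided by `C` sum to more than 1, and by subadditivity their costs total at least `expCost 1`. -/
theorem measure_late_le (h : IsCTRW p F X τ μ) (hp : IsBirthDeath p)
    (hpos : ∀ d i, ∀ᵐ t ∂F d i, 0 < t) {x : ℕ} (hx : ∀ᵐ ω ∂μ, X 0 ω = x)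
    (hI : implosionSum p F expCost ≠ ⊤) (hδ : ∑' k, scaleE p k = ⊤) {C : ℝ≥0} (hC : 1 ≤ C) :
    expCost 1 * μ {ω | (C : ℝ≥0∞) < hittingTime X τ 0 ω} ≤ implosionSum p F (slowCost C) := by
  classical
  have hC0 : (0 : ℝ) < C := by
    have : (1 : ℝ) ≤ C := by exact_mod_cast hC
    linarith
  have h1 := (h.lintegral_tsum_cost_le hp {0} (measurable_slowCost C) (poisson_costToZero hp _)).trans
    (h.lintegral_costToZero_le hx _)
  refine le_trans ?_ ((mul_meas_ge_le_lintegral (Measurable.tsum fun k =>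
    h.measurable_aliveInd_mul_cost {0} (measurable_slowCost C) k) (expCost 1)).trans h1)
  refine mul_le_mul_right (measure_mono_ae ?_) _
  filter_upwards [h.ae_exists_zero hp hpos hx hI hδ, h.ae_sojourn_pos hpos] with ω hex hs hlate
  change (C : ℝ≥0∞) < hittingTime X τ 0 ω at hlate
  have hm := hlate.trans_le (hittingTime_le hs (Nat.find_spec hex))
  rw [← ENNReal.ofReal_coe_nnreal] at hm
  replace hm := (ENNReal.ofReal_lt_ofReal_iff_of_nonneg hC0.le).1 hm
  calc expCost 1 ≤ expCost (∑ k ∈ Finset.range (Nat.find hex), sojourn X τ k ω / C) := by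
        refine expCost_mono ?_
        rw [← Finset.sum_div, one_le_div hC0]
        exact hm.le
    _ ≤ ∑ k ∈ Finset.range (Nat.find hex), expCost (sojourn X τ k ω / C) :=
        expCost_sum_le (fun k => div_nonneg (hs k).le hC0.le) _
    _ = ∑ k ∈ Finset.range (Nat.find hex),
          aliveInd X {0} (k + 1) ω * slowCost C (sojourn X τ k ω) := by
        refine Finset.sum_congr rfl fun k hk => ?_
        rw [aliveInd_of_forall, one_mul]
        · rfl
        · intro j hj
          have := Finset.mem_range.1 hk
          exact Nat.find_min hex (by omega)
    _ ≤ _ := ENNReal.sum_le_tsum _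

theorem tendsto_lateTail_zero {P : ℕ → Measure Ω} (h : ∀ i, IsCTRW p F X τ (P i))
    (hp : IsBirthDeath p) (hpos : ∀ d i, ∀ᵐ t ∂F d i, 0 < t)
    (hx : ∀ i, ∀ᵐ ω ∂P i, X 0 ω = i) (hI : implosionSum p F expCost ≠ ⊤)
    (hδ : ∑' k, scaleE p k = ⊤) : Tendsto (lateTail X τ P) atTop (𝓝 0) := by
  have hF := (h 0).isProbabilityMeasure_law
  have he : expCost 1 ≠ 0 := by simp [expCost]
  have he' : expCost 1 ≠ ⊤ := ENNReal.ofReal_ne_top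
  have hlim := ENNReal.Tendsto.div_const (tendsto_implosionSum_slowCost hpos hI)
    (Or.inr he)
  rw [ENNReal.zero_div] at hlim
  refine tendsto_of_tendsto_of_tendsto_of_le_of_le' tendsto_const_nhds hlim
    (Eventually.of_forall fun _ => zero_le) ?_
  filter_upwards [eventually_ge_atTop 1] with C hC
  refine iSup_le fun i => ?_
  rw [ENNReal.le_div_iff_mul_le (Or.inl he) (Or.inl he'), mul_comm]
  exact (h i).measure_late_le hp hpos (hx i) hI hδ hC

/-- Either `0` is hit late or the chain reaches it in bounded time. -/
theorem one_le_measure_late_add (h : IsCTRW p F X τ μ) (hpos : ∀ d i, ∀ᵐ t ∂F d i, 0 < t)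
    {x : ℕ} (hx : ∀ᵐ ω ∂μ, X 0 ω = x) (C : ℝ≥0) :
    1 ≤ μ {ω | (C : ℝ≥0∞) < hittingTime X τ 0 ω} +
      μ {ω | X 0 ω = x ∧ ∃ m, X m ω ∈ ({0} : Set ℕ) ∧ (∀ j < m, X j ω ∉ ({0} : Set ℕ)) ∧
        jumpTime X τ m ω ≤ C + 1} := by
  classical
  have := h.isProbabilityMeasure
  rw [← measure_univ (μ := μ)]
  refine (measure_mono_ae ?_).trans (measure_union_le _ _)
  filter_upwards [hx, h.ae_sojourn_pos hpos] with ω hx hs _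
  by_cases hlt : (C : ℝ≥0∞) < hittingTime X τ 0 ω
  · exact Or.inl hlt
  · refine Or.inr ⟨hx, ?_⟩
    -- The spare unit of time makes the bound strict, so that an actual visit can be extracted from
    -- the infimum.
    have hlt' : hittingTime X τ 0 ω < ((C + 1 : ℝ≥0) : ℝ≥0∞) :=
      (not_lt.1 hlt).trans_lt (by exact_mod_cast lt_add_one C)
    obtain ⟨k, hk, hkC⟩ := exists_of_hittingTime_lt hlt'
    have hex : ∃ m, X m ω ∈ ({0} : Set ℕ) := ⟨k, hk⟩
    refine ⟨Nat.find hex, Nat.find_spec hex, fun j hj => Nat.find_min hex hj, ?_⟩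
    rw [← ENNReal.ofReal_coe_nnreal] at hkC
    have h2 := (ENNReal.ofReal_lt_ofReal_iff_of_nonneg (jumpTime_nonneg hs k)).1 hkC
    refine ((jumpTime_strictMono hs).monotone (Nat.find_min' hex hk)).trans ?_
    simpa using h2.le

theorem lateTail_le_one {P : ℕ → Measure Ω} (h : ∀ i, IsCTRW p F X τ (P i)) (C : ℝ≥0) :
    lateTail X τ P C ≤ 1 := by
  have := fun i => (h i).isProbabilityMeasure
  exact iSup_le fun i => prob_le_one

/-- From `n`, the chance of reaching 0 by time C + 1 is at most e^{C+1} f_n(n) / f_n(0). The barrier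
may vary with the starting state. -/
theorem one_le_lateTail {P : ℕ → Measure Ω} (h : ∀ i, IsCTRW p F X τ (P i))
    (hp : IsBirthDeath p) (hpos : ∀ d i, ∀ᵐ t ∂F d i, 0 < t)
    (hx : ∀ i, ∀ᵐ ω ∂P i, X 0 ω = i) (C : ℝ≥0) {f : ℕ → ℕ → ℝ≥0∞}
    (hf : ∀ n i, i ∉ ({0} : Set ℕ) → laplaceOp p F (f n) i ≤ f n i)
    (h0 : ∀ n, f n 0 ≠ 0 ∨ f n n ≠ 0) (htop : ∀ n, f n n ≠ ⊤)
    (hlim : Tendsto (fun n => f n n / (ENNReal.ofReal (Real.exp (-(C + 1))) * f n 0)) atTop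
      (𝓝 0)) : 1 ≤ lateTail X τ P C := by
  have hexp : ENNReal.ofReal (Real.exp (-(C + 1))) ≠ 0 := by simpa using Real.exp_pos _
  have hle : ∀ n, 1 ≤ lateTail X τ P C +
      f n n / (ENNReal.ofReal (Real.exp (-(C + 1))) * f n 0) := fun n => by
    refine ((h n).one_le_measure_late_add hpos (hx n) C).trans (add_le_add ?_ ?_)
    · exact le_iSup (fun i => P i {ω | (C : ℝ≥0∞) < hittingTime X τ 0 ω}) n
    · rw [ENNReal.le_div_iff_mul_le ((h0 n).imp_left (mul_ne_zero hexp)) (Or.inr (htop n))]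
      exact (h n).measure_hit_le hp {0} n (C + 1) (hf n) fun i hi => by
        rw [Set.mem_singleton_iff.1 hi]
  simpa using ge_of_tendsto' (hlim.const_add _) hle

/-- Condition (I) fails in two ways. If Σ δ_k diverges, the truncated barrier has f_n(n) = 1, while
f_n(0) is 1 plus a partial sum of the divergent implosion series. If Σ δ_k converges, the scale tail
vanishes at infinity and is positive at 0. -/
theorem lateTail_eq_one {P : ℕ → Measure Ω} (h : ∀ i, IsCTRW p F X τ (P i))
    (hp : IsBirthDeath p) (hpos : ∀ d i, ∀ᵐ t ∂F d i, 0 < t)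
    (hx : ∀ i, ∀ᵐ ω ∂P i, X 0 ω = i)
    (hI : ¬ (implosionSum p F expCost ≠ ⊤ ∧ ∑' k, scaleE p k = ⊤)) (C : ℝ≥0) :
    lateTail X τ P C = 1 := by
  have hF := (h 0).isProbabilityMeasure_law
  refine le_antisymm (lateTail_le_one h C) ?_
  have hexp : ENNReal.ofReal (Real.exp (-(C + 1))) ≠ 0 := by simpa using Real.exp_pos _
  rcases eq_or_ne (∑' k, scaleE p k) ⊤ with hδ | hδ
  · have hI' : implosionSum p F expCost = ⊤ := by
      by_contra hc
      exact hI ⟨hc, hδ⟩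
    set f : ℕ → ℕ → ℝ≥0∞ := fun n i => 1 + ∑ k ∈ Finset.Ico i n, scaleE p k *
      ∑ j ∈ Finset.Ioc k n, waitMean p F expCost j * speedDensity p j with hf
    have hfn : ∀ n, f n n = 1 := fun n => by simp [hf]
    have hf0 : ∀ n, f n 0 = 1 + ∑ i ∈ Finset.range n, waitMean p F expCost (i + 1) *
        (speedDensity p (i + 1) * ∑ k ∈ Finset.range (i + 1), scaleE p k) := by
      intro n
      simp only [hf, Finset.mul_sum]
      congr 1
      -- Exchange of summation over 0 ≤ k < j ≤ n.
      rw [Finset.sum_comm' (t' := Finset.Ioc 0 n) (s' := fun j => Finset.range j)]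
      · rw [Finset.range_eq_Ico, Finset.sum_Ico_add' (fun j => ∑ k ∈ Finset.range j,
          waitMean p F expCost j * (speedDensity p j * scaleE p k)) 0 n 1]
        refine Finset.sum_congr (by ext j; simp; omega) fun j _ =>
          Finset.sum_congr rfl fun k _ => by ring
      · intro a b
        simp only [Finset.mem_Ico, Finset.mem_Ioc, Finset.mem_range]
        omega
    refine one_le_lateTail h hp hpos hx C (f := f) (fun n i hi => ?_)
      (fun n => Or.inr (by simp [hfn])) (fun n => by simp [hfn]) ?_
    · refine laplaceOp_le_of_bdOp_le hp hpos (fun i => le_self_add) ?_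
      obtain ⟨m, rfl⟩ := Nat.exists_eq_succ_of_ne_zero hi
      exact hp.bdOp_implosion _ n m
    · have h1 : Tendsto (fun n => f n 0) atTop (𝓝 ⊤) := by
        simp only [hf0]
        have := (ENNReal.summable (f := fun i => waitMean p F expCost (i + 1) *
          (speedDensity p (i + 1) * ∑ k ∈ Finset.range (i + 1), scaleE p k))).hasSum
            |>.tendsto_sum_nat.const_add 1
        rwa [← implosionSum_eq, hI', add_top] at this
      have h2 := (ENNReal.Tendsto.const_mul (a := ENNReal.ofReal (Real.exp (-(C + 1)))) h1
        (Or.inl ENNReal.top_ne_zero)).inv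
      rw [ENNReal.mul_top hexp, ENNReal.inv_top] at h2
      simpa only [hfn, one_div] using h2
  · set f : ℕ → ℝ≥0∞ := fun i => ∑' k, scaleE p (i + k) with hf
    have hf0 : f 0 = ∑' k, scaleE p k := by simp [hf]
    have hpos0 : f 0 ≠ 0 := by
      rw [hf0]
      intro h0
      exact hp.scaleE_ne_zero 0 (ENNReal.tsum_eq_zero.1 h0 0)
    have hlim : Tendsto f atTop (𝓝 0) := by
      have := ENNReal.tendsto_sum_nat_add (scaleE p) hδ
      simpa only [hf, add_comm] using this
    refine one_le_lateTail h hp hpos hx C (f := fun _ => f) (fun n i hi => ?_)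
      (fun n => Or.inl hpos0) (fun n => ?_) ?_
    · refine (laplaceOp_le_bdOp hpos _ _).trans ?_
      obtain ⟨m, rfl⟩ := Nat.exists_eq_succ_of_ne_zero hi
      exact (hp.bdOp_scale_tail m).le
    · exact ne_top_of_le_ne_top hδ
        (ENNReal.tsum_comp_le_tsum_of_injective (add_right_injective n) (scaleE p))
    · simpa using ENNReal.Tendsto.div_const hlim (Or.inr (mul_ne_zero hexp hpos0))

end IsCTRW

/-! ### All conditions as weighted series with common weights. -/

section Conditions

variable {p : ℕ → ℝ} {F : Dir → ℕ → Measure ℝ}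

theorem generalExplosionCondition_iff (hp : IsBirthDeath p) [∀ d i, IsProbabilityMeasure (F d i)]
    (hpos : ∀ d i, ∀ᵐ t ∂F d i, 0 < t) :
    GeneralExplosionCondition p F ↔ explosionSum p F < ⊤ := by
  unfold GeneralExplosionCondition explosionSum
  simp only [ofReal_bdSpeed hp hpos, mul_comm _ (ENNReal.ofReal (bdScale p _))]
  rfl

theorem generalImplosionCondition_iff (hp : IsBirthDeath p) [∀ d i, IsProbabilityMeasure (F d i)]
    (hpos : ∀ d i, ∀ᵐ t ∂F d i, 0 < t) :
    GeneralImplosionCondition p F ↔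
      implosionSum p F expCost < ⊤ ∧ ∑' k, scaleE p k = ⊤ := by
  unfold GeneralImplosionCondition implosionSum
  simp only [ofReal_bdSpeed hp hpos, mul_comm _ (ENNReal.ofReal (bdScale p _))]
  rfl

/-- The mean number of visits to `i` of the chain started there. -/
noncomputable def explosionWeight (p : ℕ → ℝ) (i : ℕ) : ℝ≥0∞ :=
  speedDensity p i * ∑' k, scaleE p (i + k)

/-- The mean number of visits to `i + 1` before hitting `0` of the chain started above. -/
noncomputable def implosionWeight (p : ℕ → ℝ) (i : ℕ) : ℝ≥0∞ :=
  speedDensity p (i + 1) * ∑ k ∈ Finset.range (i + 1), scaleE p k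

theorem explosionSum_eq (p : ℕ → ℝ) (F : Dir → ℕ → Measure ℝ) :
    explosionSum p F = ∑' i, waitMean p F expCost i * explosionWeight p i := by
  unfold explosionSum explosionWeight
  simp only [← mul_assoc, ← ENNReal.tsum_mul_left]
  rw [ENNReal.tsum_tsum_add_eq_tsum_sum_range fun i k =>
    waitMean p F expCost i * speedDensity p i * scaleE p k]
  refine tsum_congr fun k => ?_
  rw [← Finset.sum_mul, mul_comm]

theorem IsBirthDeath.speedDensity_mul_scaleE (hp : IsBirthDeath p) (i : ℕ) :
    speedDensity p i * scaleE p i = ENNReal.ofReal (1 / p i) := by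
  rw [one_div, ENNReal.ofReal_inv_of_pos (hp.pos i)]
  refine ENNReal.eq_inv_of_mul_eq_one_left ?_
  rw [← hp.ofReal_mul_scaleE_mul_speedDensity i]
  ring

theorem IsBirthDeath.speedDensity_succ_mul_scaleE (hp : IsBirthDeath p) (i : ℕ) :
    speedDensity p (i + 1) * scaleE p i = ENNReal.ofReal (1 / (1 - p (i + 1))) := by
  rw [one_div, ENNReal.ofReal_inv_of_pos (hp.2 _ (by omega)).2]
  refine ENNReal.eq_inv_of_mul_eq_one_left ?_
  rw [← hp.ofReal_mul_scaleE_mul_speedDensity (i + 1), hp.ofReal_mul_scaleE_succ]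
  ring

/-- Termwise: both sides start at 1/p_i and gain the factor q_{i+k+1}/p_{i+k+1} at each step. -/
theorem explosionWeight_eq (hp : IsBirthDeath p) (i : ℕ) :
    explosionWeight p i = ∑' k : ℕ, ENNReal.ofReal
      ((∏ j ∈ Finset.Ioc i (i + k), (1 - p j)) / ∏ j ∈ Finset.Icc i (i + k), p j) := by
  unfold explosionWeight
  rw [← ENNReal.tsum_mul_left]
  refine tsum_congr fun k => ?_
  induction k with
  | zero => simp [hp.speedDensity_mul_scaleE]
  | succ k ih =>
    have h1 : scaleE p (i + (k + 1)) = scaleE p (i + k) *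
        ENNReal.ofReal ((1 - p (i + k + 1)) / p (i + k + 1)) := by
      unfold scaleE
      rw [← add_assoc, IsBirthDeath.bdScale_succ, ENNReal.ofReal_mul (hp.bdScale_pos _).le]
    rw [h1, ← mul_assoc, ih, ← ENNReal.ofReal_mul, ← add_assoc,
      Finset.prod_Ioc_succ_top (by omega), Finset.prod_Icc_succ_top (by omega),
      div_mul_div_comm]
    exact div_nonneg (Finset.prod_nonneg fun j _ => hp.nonneg j) (hp.prod_p_pos _).le

/-- Induction on the gap m = i - k: both sides start at 1/q_{k+1} and gain the factor
p_{k+m+1}/q_{k+m+2}. -/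
theorem implosionWeight_eq (hp : IsBirthDeath p) (i : ℕ) :
    implosionWeight p i = ∑ k ∈ Finset.range (i + 1), ENNReal.ofReal
      ((∏ j ∈ Finset.Ico (k + 1) (i + 1), p j) /
        ∏ j ∈ Finset.Icc (k + 1) (i + 1), (1 - p j)) := by
  unfold implosionWeight
  rw [Finset.mul_sum]
  refine Finset.sum_congr rfl fun k hk => ?_
  obtain ⟨m, rfl⟩ := Nat.exists_eq_add_of_le (Nat.lt_succ_iff.1 (Finset.mem_range.1 hk))
  clear hk
  induction m with
  | zero => simp [hp.speedDensity_succ_mul_scaleE]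
  | succ m ih =>
    have h1 : speedDensity p (k + (m + 1) + 1) = speedDensity p (k + m + 1) *
        ENNReal.ofReal (p (k + m + 1) / (1 - p (k + m + 1 + 1))) := by
      unfold speedDensity
      rw [← ENNReal.ofReal_mul (div_pos (hp.prod_p_pos _) (hp.prod_q_pos _)).le, ← add_assoc,
        Finset.prod_Ico_succ_top (b := k + m + 1) (by omega),
        Finset.prod_Icc_succ_top (b := k + m + 1) (by omega), div_mul_div_comm]
    rw [h1, mul_right_comm, ih, ← ENNReal.ofReal_mul, ← add_assoc,
      Finset.prod_Ico_succ_top (b := k + m + 1) (by omega),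
      Finset.prod_Icc_succ_top (b := k + m + 1) (by omega), div_mul_div_comm]
    exact div_nonneg (hp.prod_p_pos _).le (Finset.prod_nonneg fun j _ => hp.nonneg j)

/-- The leading term 1/p_i suffices. This bound lets convergence of Σ w_i K_i force w_i → 0. -/
theorem one_le_explosionWeight (hp : IsBirthDeath p) (i : ℕ) : 1 ≤ explosionWeight p i := by
  calc (1 : ℝ≥0∞) ≤ speedDensity p i * scaleE p (i + 0) := by
        rw [add_zero, hp.speedDensity_mul_scaleE, ENNReal.one_le_ofReal]
        exact one_le_one_div (hp.pos i) (hp.le_one i)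
    _ ≤ _ := mul_le_mul' le_rfl (ENNReal.le_tsum 0)

theorem one_le_implosionWeight (hp : IsBirthDeath p) (i : ℕ) : 1 ≤ implosionWeight p i := by
  calc (1 : ℝ≥0∞) ≤ speedDensity p (i + 1) * scaleE p i := by
        rw [hp.speedDensity_succ_mul_scaleE, ENNReal.one_le_ofReal]
        exact one_le_one_div (hp.2 _ (by omega)).2 (by linarith [hp.pos (i + 1)])
    _ ≤ _ := mul_le_mul' le_rfl
      (Finset.single_le_sum (fun _ _ => zero_le) (Finset.self_mem_range_succ i))

theorem explosionSeriesFinite_iff (hp : IsBirthDeath p) (b : ℕ → ℝ) :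
    ExplosionSeriesFinite p b ↔ ∑' i, ENNReal.ofReal (b i) * explosionWeight p i < ⊤ := by
  simp only [ExplosionSeriesFinite, explosionWeight_eq hp]

theorem implosionSeriesCondition_iff (hp : IsBirthDeath p) (b : ℕ → ℝ) :
    ImplosionSeriesCondition p b ↔
      ∑' i, ENNReal.ofReal (b (i + 1)) * implosionWeight p i < ⊤ ∧ ∑' k, scaleE p k = ⊤ := by
  simp only [ImplosionSeriesCondition, implosionWeight_eq hp, scaleE]

/-- Comparison of weighted series, for weights which are at least `1`. -/
theorem tsum_mul_lt_top_iff {w b K : ℕ → ℝ≥0∞} {c C : ℝ≥0∞} (hK : ∀ i, 1 ≤ K i)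
    (hw : ∀ i, w i ≠ 0) (hb : ∀ i, b i ≠ ⊤) (hc : c ≠ 0) (hc' : c ≠ ⊤) (hC : C ≠ ⊤)
    (hup : ∀ i, w i ≤ C * b i) (hlow : ∀ i, c * min 1 (b i) ≤ w i) :
    ∑' i, w i * K i < ⊤ ↔ ∑' i, b i * K i < ⊤ := by
  have hwt : ∀ i, w i ≠ ⊤ := fun i => ne_top_of_le_ne_top (ENNReal.mul_ne_top hC (hb i)) (hup i)
  constructor
  · intro h
    have h0 := (ENNReal.tendsto_atTop_zero_of_tsum_ne_top h.ne).eventually_lt_const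
      (pos_iff_ne_zero.2 hc)
    obtain ⟨N, hN⟩ := eventually_atTop.1 h0
    -- From `N` on, `w i < c` forces `b i < 1`, so the lower bound reads c·b ≤ w. The finite sum
    -- takes care of the earlier indices.
    set M : ℝ≥0∞ := c⁻¹ + ∑ i ∈ Finset.range N, b i / w i with hM
    have hMt : M ≠ ⊤ := ENNReal.add_ne_top.2 ⟨ENNReal.inv_ne_top.2 hc,
      ENNReal.sum_ne_top.2 fun i _ => ENNReal.div_ne_top (hb i) (hw i)⟩
    have hbM : ∀ i, b i ≤ M * w i := by
      intro i
      rcases Nat.lt_or_ge i N with hi | hi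
      · calc b i = b i / w i * w i := (ENNReal.div_mul_cancel (hw i) (hwt i)).symm
          _ ≤ M * w i := by
            gcongr
            exact (Finset.single_le_sum (f := fun i => b i / w i) (fun _ _ => zero_le)
              (Finset.mem_range.2 hi)).trans le_add_self
      · have h1 : w i < c := lt_of_le_of_lt (le_mul_of_one_le_right' (hK i)) (hN i hi)
        have h2 : b i < 1 := by
          by_contra hge
          have := hlow i
          rw [min_eq_left (not_lt.1 hge), mul_one] at this
          exact absurd h1 (not_lt.2 this)
        have h3 := hlow i
        rw [min_eq_right h2.le] at h3
        calc b i = c⁻¹ * (c * b i) := by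
              rw [← mul_assoc, ENNReal.inv_mul_cancel hc hc', one_mul]
          _ ≤ M * w i := mul_le_mul' le_self_add h3
    calc _ ≤ ∑' i, M * (w i * K i) := ENNReal.tsum_le_tsum fun i => by
          rw [← mul_assoc]
          exact mul_le_mul' (hbM i) le_rfl
      _ = M * ∑' i, w i * K i := ENNReal.tsum_mul_left
      _ < ⊤ := ENNReal.mul_lt_top hMt.lt_top h
  · intro h
    calc _ ≤ ∑' i, C * (b i * K i) := ENNReal.tsum_le_tsum fun i => by
          rw [← mul_assoc]
          exact mul_le_mul' (hup i) le_rfl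
      _ = C * ∑' i, b i * K i := ENNReal.tsum_mul_left
      _ < ⊤ := ENNReal.mul_lt_top hC.lt_top h

theorem tsum_ofReal_lt_top_iff {b : ℕ → ℝ} (hb : ∀ i, 0 ≤ b i) :
    ∑' i, ENNReal.ofReal (b i) < ⊤ ↔ Summable b := by
  refine ⟨fun h => ?_, fun h => h.tsum_ofReal_lt_top⟩
  simpa only [ENNReal.toReal_ofReal (hb _)] using ENNReal.summable_toReal h.ne

end Conditions

/-! ### Homogeneous chains. -/

section Homogeneous

variable {p b : ℕ → ℝ} {r : ℝ}

theorem scaleE_homogeneous (hr : ∀ i, 1 ≤ i → p i = r) (hp : IsBirthDeath p) (k : ℕ) :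
    scaleE p k = ENNReal.ofReal ((1 - r) / r) ^ k := by
  have h1 := hp.2 1 le_rfl
  rw [hr 1 le_rfl] at h1
  unfold scaleE bdScale
  rw [← ENNReal.ofReal_pow (div_nonneg h1.2.le h1.1.le),
    Finset.prod_congr rfl fun j hj => by rw [hr j (Finset.mem_Icc.1 hj).1]]
  simp [div_pow]

theorem tsum_scaleE_homogeneous_lt_top_iff (hr : ∀ i, 1 ≤ i → p i = r) (hp : IsBirthDeath p) :
    ∑' k, scaleE p k < ⊤ ↔ r > 1 - r := by
  have h1 := hp.2 1 le_rfl
  rw [hr 1 le_rfl] at h1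
  simp only [scaleE_homogeneous hr hp, ENNReal.tsum_geometric, ENNReal.inv_lt_top, tsub_pos_iff_lt,
    ENNReal.ofReal_lt_one, div_lt_one h1.1, gt_iff_lt]

/-- The scale is geometric, so K_i is Σ δ_k divided by p_i: finite only for r > 1 - r, and then
bounded in i. -/
theorem explosionSeriesFinite_homogeneous (hr : ∀ i, 1 ≤ i → p i = r) (hp : IsBirthDeath p)
    (hb : ∀ i, 0 < b i) : ExplosionSeriesFinite p b ↔ Summable b ∧ r > 1 - r := by
  have h1 := hp.2 1 le_rfl
  rw [hr 1 le_rfl] at h1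
  rw [explosionSeriesFinite_iff hp, ← tsum_ofReal_lt_top_iff fun i => (hb i).le,
    ← tsum_scaleE_homogeneous_lt_top_iff hr hp]
  have hK : ∀ i, explosionWeight p i = ENNReal.ofReal (1 / p i) * ∑' k, scaleE p k := by
    intro i
    unfold explosionWeight
    rw [← hp.speedDensity_mul_scaleE, mul_assoc, ← ENNReal.tsum_mul_left (a := scaleE p i)]
    simp only [scaleE_homogeneous hr hp, pow_add]
  constructor
  · refine fun h => ⟨lt_of_le_of_lt (ENNReal.tsum_le_tsum fun i =>
      le_mul_of_one_le_right' (one_le_explosionWeight hp i)) h, ?_⟩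
    have h0 := (ENNReal.le_tsum 0).trans_lt h
    have h2 := ENNReal.lt_top_of_mul_ne_top_right h0.ne (by simpa using hb 0)
    rw [hK, hp.1] at h2
    simpa using h2
  · rintro ⟨hs, hδ⟩
    have hM : ∀ i, explosionWeight p i ≤ ENNReal.ofReal (1 / r) * ∑' k, scaleE p k := by
      intro i
      rw [hK]
      refine mul_le_mul' (ENNReal.ofReal_le_ofReal ?_) le_rfl
      rcases Nat.eq_zero_or_pos i with rfl | hi
      · rw [hp.1]
        exact one_div_le_one_div_of_le h1.1 (by linarith)
      · rw [hr i hi]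
    refine lt_of_le_of_lt (ENNReal.tsum_le_tsum fun i => mul_le_mul' le_rfl (hM i)) ?_
    rw [ENNReal.tsum_mul_right]
    exact ENNReal.mul_lt_top hs (ENNReal.mul_lt_top ENNReal.ofReal_lt_top hδ)

/-- Read backwards, the sum has terms δ_{i-j} = δ_i (r/(1-r))^j. -/
theorem implosionWeight_homogeneous (hr : ∀ i, 1 ≤ i → p i = r) (hp : IsBirthDeath p) (i : ℕ) :
    implosionWeight p i = ENNReal.ofReal (1 / (1 - r)) *
      ∑ j ∈ Finset.range (i + 1), ENNReal.ofReal (r / (1 - r)) ^ j := by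
  have h1 := hp.2 1 le_rfl
  rw [hr 1 le_rfl] at h1
  have h2 := hp.speedDensity_succ_mul_scaleE i
  rw [hr _ (by omega)] at h2
  unfold implosionWeight
  rw [← h2, mul_assoc, ← Finset.sum_range_reflect, Finset.mul_sum (a := scaleE p i)]
  congr 1
  refine Finset.sum_congr rfl fun j hj => ?_
  have hj' : i = (i + 1 - 1 - j) + j := by
    have := Finset.mem_range.1 hj
    omega
  have hxy : ENNReal.ofReal ((1 - r) / r) * ENNReal.ofReal (r / (1 - r)) = 1 := by
    rw [← ENNReal.ofReal_mul (div_nonneg h1.2.le h1.1.le), div_mul_div_comm, mul_comm r,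
      div_self (mul_pos h1.2 h1.1).ne', ENNReal.ofReal_one]
  conv_rhs => rw [hj']
  rw [scaleE_homogeneous hr hp, scaleE_homogeneous hr hp, pow_add, mul_assoc, ← mul_pow, hxy,
    one_pow, mul_one]

/-- The weights are bounded for r < 1 - r and proportional to i + 1 for r = 1 - r; for r > 1 - r the
series Σ δ_k converges. -/
theorem implosionSeriesCondition_homogeneous (hr : ∀ i, 1 ≤ i → p i = r) (hp : IsBirthDeath p)
    (hb : ∀ i, 0 < b i) : ImplosionSeriesCondition p b ↔
      (Summable b ∧ r < 1 - r) ∨ (Summable (fun i : ℕ => (i : ℝ) * b i) ∧ r = 1 - r) := by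
  have h1 := hp.2 1 le_rfl
  rw [hr 1 le_rfl] at h1
  have hδ : ∑' k, scaleE p k = ⊤ ↔ r ≤ 1 - r := by
    rw [← not_lt, ← gt_iff_lt, ← tsum_scaleE_homogeneous_lt_top_iff hr hp, not_lt_top_iff]
  rw [implosionSeriesCondition_iff hp, hδ]
  rcases lt_trichotomy r (1 - r) with h | h | h
  · have hsum : ∑' i, ENNReal.ofReal (b (i + 1)) * implosionWeight p i < ⊤ ↔ Summable b := by
      rw [← summable_nat_add_iff 1, ← tsum_ofReal_lt_top_iff fun i => (hb (i + 1)).le]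
      constructor
      · exact lt_of_le_of_lt (ENNReal.tsum_le_tsum fun i =>
          le_mul_of_one_le_right' (one_le_implosionWeight hp i))
      · intro hs
        have hM : ∀ i, implosionWeight p i ≤ ENNReal.ofReal (1 / (1 - r)) *
            (1 - ENNReal.ofReal (r / (1 - r)))⁻¹ := by
          intro i
          rw [implosionWeight_homogeneous hr hp, ← ENNReal.tsum_geometric]
          exact mul_le_mul' le_rfl (ENNReal.sum_le_tsum _)
        refine lt_of_le_of_lt (ENNReal.tsum_le_tsum fun i => mul_le_mul' le_rfl (hM i)) ?_
        rw [ENNReal.tsum_mul_right]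
        refine ENNReal.mul_lt_top hs (ENNReal.mul_lt_top ENNReal.ofReal_lt_top ?_)
        rwa [ENNReal.inv_lt_top, tsub_pos_iff_lt, ENNReal.ofReal_lt_one, div_lt_one h1.2]
    simp [hsum, h, h.le, h.ne]
  · have hK : ∀ i, implosionWeight p i = ENNReal.ofReal (1 / (1 - r)) * (i + 1 : ℕ) := by
      intro i
      rw [implosionWeight_homogeneous hr hp, ← h, div_self h1.1.ne']
      simp
    have hsum : ∑' i, ENNReal.ofReal (b (i + 1)) * implosionWeight p i < ⊤ ↔
        Summable (fun i : ℕ => (i : ℝ) * b i) := by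
      rw [← summable_nat_add_iff 1, ← tsum_ofReal_lt_top_iff fun i =>
        mul_nonneg (Nat.cast_nonneg _) (hb (i + 1)).le]
      have e : ∀ i, ENNReal.ofReal (b (i + 1)) * implosionWeight p i =
          ENNReal.ofReal (1 / (1 - r)) * ENNReal.ofReal ((i + 1 : ℕ) * b (i + 1)) := fun i => by
        rw [hK, ENNReal.ofReal_mul (Nat.cast_nonneg _), ENNReal.ofReal_natCast]
        ring
      simp only [e, ENNReal.tsum_mul_left]
      have h0 : ENNReal.ofReal (1 / (1 - r)) ≠ 0 := by simpa using h1.2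
      exact ⟨fun H => ENNReal.lt_top_of_mul_ne_top_right H.ne h0,
        fun H => ENNReal.mul_lt_top ENNReal.ofReal_lt_top H⟩
    simp [hsum, ← h]
  · simp [h.ne', not_le.2 h, not_lt.2 h.le]

end Homogeneous

/-! ### The criteria from two-sided bounds on the mean cost. -/

theorem le_waitMean {p : ℕ → ℝ} {F : Dir → ℕ → Measure ℝ} (hp : IsBirthDeath p) {c : ℝ → ℝ≥0∞}
    {i : ℕ} {a : ℝ≥0∞} (h : ∀ d, a ≤ ∫⁻ t, c t ∂F d i) : a ≤ waitMean p F c i := by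
  rw [← one_mul a, ← hp.ofReal_add i, add_mul]
  exact add_le_add (mul_le_mul' le_rfl (h _)) (mul_le_mul' le_rfl (h _))

theorem waitMean_le {p : ℕ → ℝ} {F : Dir → ℕ → Measure ℝ} (hp : IsBirthDeath p) {c : ℝ → ℝ≥0∞}
    {i : ℕ} {a : ℝ≥0∞} (h : ∀ d, ∫⁻ t, c t ∂F d i ≤ a) : waitMean p F c i ≤ a := by
  rw [← one_mul a, ← hp.ofReal_add i, add_mul]
  exact add_le_add (mul_le_mul' le_rfl (h _)) (mul_le_mul' le_rfl (h _))

/-- The series criteria hold whenever `1 - E exp (-τ_i)` is comparable with `min 1 (b_i)`. -/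
theorem seriesCriteria_of_comparable {p : ℕ → ℝ} (hp : IsBirthDeath p)
    {F : Dir → ℕ → Measure ℝ} [∀ d i, IsProbabilityMeasure (F d i)]
    (hpos : ∀ d i, ∀ᵐ t ∂F d i, 0 < t) {b : ℕ → ℝ} (hb : ∀ i, 0 < b i) {c C : ℝ≥0∞}
    (hc : c ≠ 0) (hc' : c ≠ ⊤) (hC : C ≠ ⊤)
    (hup : ∀ d i, ∫⁻ t, expCost t ∂F d i ≤ C * ENNReal.ofReal (b i))
    (hlow : ∀ d i, c * min 1 (ENNReal.ofReal (b i)) ≤ ∫⁻ t, expCost t ∂F d i) :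
    SeriesCriteria.{u} p F b := by
  have hw : ∀ i, waitMean p F expCost i ≠ 0 := fun i => (waitMean_expCost_pos hp hpos i).ne'
  have hup' : ∀ i, waitMean p F expCost i ≤ C * ENNReal.ofReal (b i) := fun i =>
    waitMean_le hp fun d => hup d i
  have hlow' : ∀ i, c * min 1 (ENNReal.ofReal (b i)) ≤ waitMean p F expCost i := fun i =>
    le_waitMean hp fun d => hlow d i
  have hE : explosionSum p F < ⊤ ↔ ExplosionSeriesFinite p b := by
    rw [explosionSum_eq, explosionSeriesFinite_iff hp]
    exact tsum_mul_lt_top_iff (one_le_explosionWeight hp) hw (fun i => ENNReal.ofReal_ne_top)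
      hc hc' hC hup' hlow'
  have hI : (implosionSum p F expCost < ⊤ ∧ ∑' k, scaleE p k = ⊤) ↔
      ImplosionSeriesCondition p b := by
    rw [implosionSum_eq, implosionSeriesCondition_iff hp]
    refine and_congr_left fun _ => ?_
    exact tsum_mul_lt_top_iff (one_le_implosionWeight hp) (fun i => hw (i + 1))
      (fun i => ENNReal.ofReal_ne_top) hc hc' hC (fun i => hup' (i + 1)) fun i => hlow' (i + 1)
  refine ⟨(generalExplosionCondition_iff hp hpos).trans hE,
    (generalImplosionCondition_iff hp hpos).trans hI, ?_, ?_, ?_, ?_⟩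
  · intro Ω _ X τ μ h
    have := h.isProbabilityMeasure
    rw [← hE]
    by_cases hfin : explosionSum p F < ⊤
    · have h1 : μ (explosionEvent X τ) = 1 := by
        rw [← measure_univ (μ := μ)]
        refine measure_congr ?_
        filter_upwards [h.ae_mem_explosionEvent hp hpos hfin.ne] with ω hω
        exact propext ⟨fun _ => trivial, fun _ => hω⟩
      simp [h1, hfin]
    · have h0 := h.measure_explosionEvent_eq_zero hp hpos (not_lt_top_iff.1 hfin)
      simp [h0, hfin]
  · intro Ω _ X τ P h hx
    rw [← hI]
    unfold Implodes
    by_cases hfin : implosionSum p F expCost < ⊤ ∧ ∑' k, scaleE p k = ⊤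
    · have h0 := IsCTRW.tendsto_lateTail_zero h hp hpos hx hfin.1.ne hfin.2
      exact ⟨iff_of_true h0 hfin, iff_of_false
        (fun h1 => zero_ne_one (tendsto_nhds_unique h0 h1)) (not_not.2 hfin)⟩
    · have h1 : Tendsto (lateTail X τ P) atTop (𝓝 1) := by
        rw [show lateTail X τ P = fun _ => 1 from funext (IsCTRW.lateTail_eq_one h hp hpos hx
          fun H => hfin ⟨H.1.lt_top, H.2⟩)]
        exact tendsto_const_nhds
      exact ⟨iff_of_false (fun h0 => zero_ne_one (tendsto_nhds_unique h0 h1)) hfin,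
        iff_of_true h1 hfin⟩
  · exact fun r hr => explosionSeriesFinite_homogeneous hr hp hb
  · exact fun r hr => implosionSeriesCondition_homogeneous hr hp hb

/-! ### Scaled waiting times of finite mean. -/

section Scaling

theorem ae_pos_map_div {m : Measure ℝ} (hm : ∀ᵐ x ∂m, 0 < x) {a : ℝ} (ha : 0 < a) :
    ∀ᵐ x ∂m.map (fun x => x / a), 0 < x := by
  rw [ae_map_iff (measurable_id'.div_const a).aemeasurable measurableSet_Ioi]
  filter_upwards [hm] with x hx
  exact div_pos hx ha

theorem isProbabilityMeasure_map_div (m : Measure ℝ) [IsProbabilityMeasure m] (a : ℝ) :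
    IsProbabilityMeasure (m.map fun x => x / a) :=
  Measure.isProbabilityMeasure_map (measurable_id'.div_const a).aemeasurable

theorem lintegral_expCost_map_div (m : Measure ℝ) (a : ℝ) :
    ∫⁻ t, expCost t ∂(m.map fun x => x / a) = ∫⁻ x, expCost (x / a) ∂m :=
  lintegral_map measurable_expCost (measurable_id'.div_const a)

theorem expCost_le_ofReal (t : ℝ) : expCost t ≤ ENNReal.ofReal t :=
  ENNReal.ofReal_le_ofReal (by linarith [Real.add_one_le_exp (-t)])

/-- Concavity of `1 - exp (-t)`. -/
theorem min_one_mul_expCost_le {s x : ℝ} (hs : 0 < s) (hx : 0 < x) :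
    expCost x * min 1 (ENNReal.ofReal s) ≤ expCost (x * s) := by
  rcases le_total 1 s with h | h
  · calc _ ≤ expCost x * 1 := mul_le_mul' le_rfl (min_le_left _ _)
      _ = expCost x := mul_one _
      _ ≤ _ := expCost_mono (le_mul_of_one_le_right hx.le h)
  · refine (mul_le_mul' le_rfl (min_le_right _ _)).trans ?_
    unfold expCost
    rw [← ENNReal.ofReal_mul' hs.le]
    refine ENNReal.ofReal_le_ofReal ?_
    have := convexOn_exp.2 (Set.mem_univ (-x)) (Set.mem_univ 0) hs.le (sub_nonneg.2 h) (by ring)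
    simp only [smul_eq_mul, mul_zero, add_zero, Real.exp_zero, mul_one] at this
    rw [show -(x * s) = s * -x by ring]
    linarith

/-- The criteria for scaled waiting times of finite mean. -/
theorem seriesCriteria_of_finite_mean {p : ℕ → ℝ} (hp : IsBirthDeath p) {a : ℕ → ℝ}
    (ha : ∀ i, 0 < a i) (m : Dir → Measure ℝ) [∀ d, IsProbabilityMeasure (m d)]
    (hm : ∀ d, ∀ᵐ x ∂m d, 0 < x) (hfin : ∀ d, ∫⁻ x, ENNReal.ofReal x ∂m d ≠ ⊤) :
    SeriesCriteria.{u} p (fun d i => (m d).map fun x => x / a i) fun i => 1 / a i := by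
  have hprob : ∀ d i, IsProbabilityMeasure ((m d).map fun x => x / a i) := fun d i =>
    isProbabilityMeasure_map_div (m d) (a i)
  have hle : ∀ d, ∫⁻ x, expCost x ∂m d ≤ 1 := fun d =>
    le_add_self.trans (lintegral_exp_add_expCost (hm d)).le
  have hinv : ∀ i, 0 < 1 / a i := fun i => one_div_pos.2 (ha i)
  -- The constants are the unit-scale means of 1 - e^{-t} and of t. Their minimum and sum over
  -- directions serve both kinds of jump.
  set c : Dir → ℝ≥0∞ := fun d => ∫⁻ x, expCost x ∂m d with hc
  set C : Dir → ℝ≥0∞ := fun d => ∫⁻ x, ENNReal.ofReal x ∂m d with hC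
  refine seriesCriteria_of_comparable hp (fun d i => ae_pos_map_div (hm d) (ha i)) hinv
    (c := min (c Dir.right) (c Dir.left)) (C := C Dir.right + C Dir.left)
    (lt_min (lintegral_expCost_pos (hm _)) (lintegral_expCost_pos (hm _))).ne'
    (ne_top_of_le_ne_top ENNReal.one_ne_top ((min_le_left _ _).trans (hle _)))
    (ENNReal.add_ne_top.2 ⟨hfin _, hfin _⟩) (fun d i => ?_) fun d i => ?_
  · calc _ = ∫⁻ x, expCost (x / a i) ∂m d := lintegral_expCost_map_div _ _
      _ ≤ ∫⁻ x, ENNReal.ofReal x * ENNReal.ofReal (1 / a i) ∂m d := by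
        refine lintegral_mono fun x => (expCost_le_ofReal _).trans ?_
        rw [← ENNReal.ofReal_mul' (hinv i).le, mul_one_div]
      _ = C d * ENNReal.ofReal (1 / a i) := lintegral_mul_const _ ENNReal.measurable_ofReal
      _ ≤ _ := by
        refine mul_le_mul' ?_ le_rfl
        cases d
        exacts [le_self_add, le_add_self]
  · calc _ ≤ c d * min 1 (ENNReal.ofReal (1 / a i)) := by
          refine mul_le_mul' ?_ le_rfl
          cases d
          exacts [min_le_left _ _, min_le_right _ _]
      _ = ∫⁻ x, expCost x * min 1 (ENNReal.ofReal (1 / a i)) ∂m d :=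
          (lintegral_mul_const _ measurable_expCost).symm
      _ ≤ ∫⁻ x, expCost (x / a i) ∂m d := by
          refine lintegral_mono_ae ?_
          filter_upwards [hm d] with x hx
          rw [← mul_one_div x]
          exact min_one_mul_expCost_le (hinv i) hx
      _ = _ := (lintegral_expCost_map_div _ _).symm

end Scaling

/-! ### Exponential waiting times. -/

section Exponential

/-- Comparison of distribution functions; it makes the Markov case an instance of finite means. -/
theorem expMeasure_eq_map_div {a : ℝ} (ha : 0 < a) :
    expMeasure a = (expMeasure 1).map fun x => x / a := by
  have := isProbabilityMeasure_expMeasure ha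
  have := isProbabilityMeasure_expMeasure one_pos
  have := isProbabilityMeasure_map_div (expMeasure 1) a
  refine Measure.eq_of_cdf _ _ (StieltjesFunction.ext fun x => ?_)
  have h1 : cdf ((expMeasure 1).map fun x => x / a) x = cdf (expMeasure 1) (a * x) := by
    rw [cdf_eq_real, cdf_eq_real, map_measureReal_apply (measurable_id'.div_const a)
      measurableSet_Iic]
    congr 1
    ext y
    simp only [Set.mem_preimage, Set.mem_Iic, div_le_iff₀ ha, mul_comm]
  rw [h1, cdf_expMeasure_eq ha, cdf_expMeasure_eq one_pos, one_mul]
  simp only [mul_nonneg_iff_of_pos_left ha]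

theorem ae_pos_expMeasure {a : ℝ} (ha : 0 < a) : ∀ᵐ x ∂expMeasure a, 0 < x := by
  have := isProbabilityMeasure_expMeasure ha
  have h := cdf_expMeasure_eq ha 0
  rw [cdf_eq_real] at h
  simp only [le_refl, if_true, mul_zero, neg_zero, Real.exp_zero, sub_self] at h
  rw [measureReal_eq_zero_iff] at h
  rw [ae_iff, show {x : ℝ | ¬ 0 < x} = Set.Iic 0 by ext x; simp]
  exact h

/-- The mean is the convergent integral defining Γ(2). -/
theorem lintegral_ofReal_expMeasure_one_ne_top :
    ∫⁻ x, ENNReal.ofReal x ∂expMeasure 1 ≠ ⊤ := by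
  have hint := Real.GammaIntegral_convergent (s := 2) two_pos
  have hden : expMeasure 1 = volume.withDensity (exponentialPDF 1) := rfl
  have hmeas : Measurable (exponentialPDF 1) :=
    (measurable_exponentialPDFReal 1).ennreal_ofReal
  rw [hden, lintegral_withDensity_eq_lintegral_mul _ hmeas ENNReal.measurable_ofReal]
  refine ne_top_of_le_ne_top hint.lintegral_lt_top.ne ?_
  rw [← lintegral_indicator measurableSet_Ioi]
  refine lintegral_mono fun x => ?_
  rcases lt_or_ge 0 x with hx | hx
  · simp only [Pi.mul_apply, exponentialPDF_of_nonneg hx.le, one_mul]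
    rw [Set.indicator_of_mem (Set.mem_Ioi.2 hx), ← ENNReal.ofReal_mul (Real.exp_pos _).le]
    norm_num
  · simp [ENNReal.ofReal_of_nonpos hx]

end Exponential

/-! ### Stable waiting times. -/

section Stable

/-- The Laplace transform of `m`. -/
noncomputable def laplace (m : Measure ℝ) (s : ℝ) : ℝ := ∫ x, Real.exp (-(s * x)) ∂m

variable {m : Measure ℝ} [IsProbabilityMeasure m]

theorem integrable_exp_neg_mul (hm : ∀ᵐ x ∂m, 0 < x) {s : ℝ} (hs : 0 ≤ s) :
    Integrable (fun x => Real.exp (-(s * x))) m := by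
  refine Integrable.of_bound (Measurable.aestronglyMeasurable (by fun_prop)) 1 ?_
  filter_upwards [hm] with x hx
  simpa using mul_nonneg hs hx.le

theorem laplace_antitone (hm : ∀ᵐ x ∂m, 0 < x) {s t : ℝ} (hs : 0 ≤ s) (hst : s ≤ t) :
    laplace m t ≤ laplace m s := by
  refine integral_mono_ae (integrable_exp_neg_mul hm (hs.trans hst))
    (integrable_exp_neg_mul hm hs) ?_
  filter_upwards [hm] with x hx
  simp only [Real.exp_le_exp, neg_le_neg_iff]
  gcongr

theorem laplace_pos (hm : ∀ᵐ x ∂m, 0 < x) {s : ℝ} (hs : 0 ≤ s) : 0 < laplace m s :=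
  integral_exp_pos (integrable_exp_neg_mul hm hs)

theorem lintegral_expCost_div (hm : ∀ᵐ x ∂m, 0 < x) {a : ℝ} (ha : 0 < a) :
    ∫⁻ x, expCost (x / a) ∂m = ENNReal.ofReal (1 - laplace m (1 / a)) := by
  have hint := integrable_exp_neg_mul hm (one_div_pos.2 ha).le
  unfold laplace
  have e : 1 - ∫ x, Real.exp (-(1 / a * x)) ∂m = ∫ x, (1 - Real.exp (-(1 / a * x))) ∂m := by
    rw [integral_sub (integrable_const 1) hint]
    simp
  rw [e, ofReal_integral_eq_lintegral_ofReal (f := fun x => 1 - Real.exp (-(1 / a * x)))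
    ((integrable_const 1).sub hint)]
  · refine lintegral_congr fun x => ?_
    rw [one_div_mul_eq_div]
    rfl
  · filter_upwards [hm] with x hx
    simpa using mul_nonneg (inv_pos.2 ha).le hx.le

theorem laplace_lt_one (hm : ∀ᵐ x ∂m, 0 < x) : laplace m 1 < 1 := by
  have h := lintegral_expCost_pos hm
  have e := lintegral_expCost_div hm one_pos
  simp only [div_one] at e
  rw [e, ENNReal.ofReal_pos] at h
  linarith

end Stable

/-- Independence turns the transform of the sum into a power, and stability turns the sum into a
rescaling. -/
theorem IsPositiveStable.laplace_pow {α : ℝ} {m : Measure ℝ}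
    (h : IsPositiveStable α m) {n : ℕ} (hn : 1 ≤ n) (s : ℝ) : laplace m ((n : ℝ) ^ (1 / α) * s) = laplace m s ^ n := by
  have := h.isProbabilityMeasure
  have h1 : ∫ y, Real.exp (-(s * y)) ∂((Measure.pi fun _ : Fin n => m).map fun x => ∑ i, x i) =
      laplace m s ^ n := by
    rw [integral_map (Measurable.aemeasurable (by fun_prop))
      (Measurable.aestronglyMeasurable (by fun_prop))]
    have := integral_fintype_prod_eq_pow (ι := Fin n) (μ := m)
      fun x : ℝ => Real.exp (-(s * x))
    rw [Fintype.card_fin] at this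
    unfold laplace
    rw [← this]
    refine integral_congr_ae (ae_of_all _ fun x => ?_)
    simp only
    rw [← Real.exp_sum, Finset.mul_sum, Finset.sum_neg_distrib]
  rw [← h1, h.stable n hn, integral_map (Measurable.aemeasurable (by fun_prop))
      (Measurable.aestronglyMeasurable (by fun_prop))]
  unfold laplace
  refine integral_congr_ae (ae_of_all _ fun x => ?_)
  simp only
  congr 2
  ring

/-- Two-sided bounds for the Laplace transform of a positive stable law. -/
theorem IsPositiveStable.one_sub_laplace_bounds {α : ℝ} (hα : 0 < α) {m : Measure ℝ}
    (h : IsPositiveStable α m) {s : ℝ} (hs : 0 < s) :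
    1 - laplace m s ≤ max 1 (2 * -Real.log (laplace m 1)) * s ^ α ∧
      (1 - laplace m 1) / 2 * min 1 (s ^ α) ≤ 1 - laplace m s := by
  have := h.isProbabilityMeasure
  have hm := h.pos
  have hlt := laplace_lt_one hm
  have hpos := laplace_pos hm zero_le_one
  have hps := laplace_pos hm hs.le
  have hsα : 0 < s ^ α := Real.rpow_pos_of_pos hs α
  rcases le_total 1 s with h1 | h1
  · have h2 : 1 ≤ s ^ α := Real.one_le_rpow h1 hα.le
    have h3 := laplace_antitone hm zero_le_one h1
    refine ⟨?_, ?_⟩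
    · calc 1 - laplace m s ≤ 1 * 1 := by linarith
        _ ≤ _ := mul_le_mul (le_max_left _ _) h2 zero_le_one (by positivity)
    · rw [min_eq_left h2]
      linarith
  · have h2 : s ^ α ≤ 1 := Real.rpow_le_one hs.le h1 hα.le
    -- `t` is the real "number of copies" that brings scale s up to 1. Rounding it down gives L(1) ≤
    -- L(s)^n, rounding up the reverse. As t ≥ 1, each rounding costs at most a factor 2.
    set t := (s ^ α)⁻¹ with ht
    have ht1 : 1 ≤ t := (one_le_inv₀ hsα).2 h2
    have hts : t * s ^ α = 1 := inv_mul_cancel₀ hsα.ne'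
    have htα : t ^ (1 / α) * s = 1 := by
      rw [ht, Real.inv_rpow hsα.le, ← Real.rpow_mul hs.le, mul_one_div_cancel hα.ne',
        Real.rpow_one, inv_mul_cancel₀ hs.ne']
    refine ⟨?_, ?_⟩
    · set n := ⌊t⌋₊ with hn
      have hn1 : 1 ≤ n := Nat.one_le_floor_iff _ |>.2 ht1
      have hnR : (1 : ℝ) ≤ n := by exact_mod_cast hn1
      have hnt : (n : ℝ) ≤ t := Nat.floor_le (by linarith)
      have htn : t < n + 1 := Nat.lt_floor_add_one t
      have hle : laplace m 1 ≤ laplace m s ^ n := by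
        rw [← h.laplace_pow hn1]
        refine laplace_antitone hm (by positivity) ?_
        calc _ ≤ t ^ (1 / α) * s := by gcongr
          _ = 1 := htα
      have hlog : Real.log (laplace m 1) ≤ n * Real.log (laplace m s) := by
        rw [← Real.log_pow]
        exact Real.log_le_log hpos hle
      have hl1 := Real.log_le_sub_one_of_pos hps
      have hneg : 0 < -Real.log (laplace m 1) := by
        have := Real.log_neg hpos hlt
        linarith
      calc 1 - laplace m s ≤ -Real.log (laplace m s) := by linarith
        _ ≤ -Real.log (laplace m 1) / n := by
          rw [le_div_iff₀ (by linarith)]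
          linarith
        _ ≤ 2 * -Real.log (laplace m 1) * s ^ α := by
          rw [div_le_iff₀ (by linarith)]
          have h3 : 1 ≤ 2 * (s ^ α * n) := by
            calc 1 = t * s ^ α := hts.symm
              _ ≤ (2 * n) * s ^ α := by gcongr; linarith
              _ = _ := by ring
          calc -Real.log (laplace m 1) = -Real.log (laplace m 1) * 1 := (mul_one _).symm
            _ ≤ -Real.log (laplace m 1) * (2 * (s ^ α * n)) := by gcongr
            _ = _ := by ring
        _ ≤ _ := by gcongr; exact le_max_right _ _
    · rw [min_eq_right h2]
      set n := ⌈t⌉₊ with hn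
      have hn1 : 1 ≤ n := Nat.one_le_ceil_iff.2 (by linarith)
      have hnt : t ≤ n := Nat.le_ceil t
      have htn : (n : ℝ) < t + 1 := Nat.ceil_lt_add_one (by linarith)
      have hle : laplace m s ^ n ≤ laplace m 1 := by
        rw [← h.laplace_pow hn1]
        refine laplace_antitone hm zero_le_one ?_
        calc 1 = t ^ (1 / α) * s := htα.symm
          _ ≤ _ := by gcongr
      -- Bernoulli's inequality linearises L(s)^n ≤ L(1) to 1 - L(1) ≤ n(1 - L(s)).
      have hbern := one_add_mul_le_pow (a := laplace m s - 1) (by linarith) n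
      rw [add_sub_cancel] at hbern
      have h3 : 1 - laplace m 1 ≤ n * (1 - laplace m s) := by linarith
      have hnn : 0 ≤ 1 - laplace m s := by
        by_contra hc
        have : (n : ℝ) * (1 - laplace m s) ≤ 0 :=
          mul_nonpos_of_nonneg_of_nonpos (Nat.cast_nonneg _) (by linarith)
        linarith
      have h4 : (1 - laplace m 1) ≤ (2 * t) * (1 - laplace m s) :=
        h3.trans (mul_le_mul_of_nonneg_right (by linarith) hnn)
      calc (1 - laplace m 1) / 2 * s ^ α ≤ (2 * t) * (1 - laplace m s) / 2 * s ^ α := by gcongr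
        _ = (t * s ^ α) * (1 - laplace m s) := by ring
        _ = _ := by rw [hts, one_mul]

theorem seriesCriteria_of_stable {p : ℕ → ℝ} (hp : IsBirthDeath p) {a : ℕ → ℝ}
    (ha : ∀ i, 0 < a i) {α : ℝ} (hα : 0 < α) {m : Measure ℝ} (h : IsPositiveStable α m) :
    SeriesCriteria.{u} p (fun _ i => m.map fun x => x / a i) fun i => 1 / a i ^ α := by
  have := h.isProbabilityMeasure
  let F : Dir → ℕ → Measure ℝ := fun _ i => m.map fun x => x / a i
  have hprob : ∀ d i, IsProbabilityMeasure (F d i) := fun _ i =>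
    isProbabilityMeasure_map_div m (a i)
  have hcost : ∀ d i, ∫⁻ t, expCost t ∂F d i = ENNReal.ofReal (1 - laplace m (1 / a i)) :=
    fun _ i => (lintegral_expCost_map_div m (a i)).trans (lintegral_expCost_div h.pos (ha i))
  have hb : ∀ i, 0 < 1 / a i ^ α := fun i => one_div_pos.2 (Real.rpow_pos_of_pos (ha i) α)
  have hlt := laplace_lt_one h.pos
  have hc : 0 < (1 - laplace m 1) / 2 := by linarith
  have hbd : ∀ i, _ := fun i => h.one_sub_laplace_bounds hα (one_div_pos.2 (ha i))
  simp only [Real.div_rpow zero_le_one (ha _).le, Real.one_rpow] at hbd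
  refine @seriesCriteria_of_comparable p hp F hprob (fun _ i => ae_pos_map_div h.pos (ha i)) _ hb
    (ENNReal.ofReal ((1 - laplace m 1) / 2))
    (ENNReal.ofReal (max 1 (2 * -Real.log (laplace m 1))))
    (ENNReal.ofReal_pos.2 hc).ne' ENNReal.ofReal_ne_top ENNReal.ofReal_ne_top
    (fun d i => ?_) fun d i => ?_
  · rw [hcost d i, ← ENNReal.ofReal_mul' (hb i).le]
    exact ENNReal.ofReal_le_ofReal (hbd i).1
  · rw [hcost d i, ← ENNReal.ofReal_one, ← ENNReal.ofReal_min, ← ENNReal.ofReal_mul hc.le]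
    exact ENNReal.ofReal_le_ofReal (hbd i).2

theorem mainTheorem4 (p : ℕ → ℝ) (hp : IsBirthDeath p) (a : ℕ → ℝ) (ha : ∀ i, 0 < a i) :
    SeriesCriteria.{u} p (fun _ i => expMeasure (a i)) (fun i => 1 / a i) ∧
    (∀ m : Dir → Measure ℝ, (∀ d, IsProbabilityMeasure (m d)) → (∀ d, ∀ᵐ x ∂(m d), 0 < x) →
      (∀ d, Integrable (fun x => x) (m d)) →
      ∫ x, x ∂(m Dir.right) = ∫ x, x ∂(m Dir.left) →
      SeriesCriteria.{u} p (fun d i => (m d).map (fun x => x / a i)) (fun i => 1 / a i)) ∧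
    (∀ (α : ℝ) (m : Measure ℝ), 0 < α → α < 1 → IsPositiveStable α m →
      SeriesCriteria.{u} p (fun _ i => m.map (fun x => x / a i)) (fun i => 1 / a i ^ α)) := by
  refine ⟨?_, fun m hprob hm hint _ => ?_, fun α m hα _ h => seriesCriteria_of_stable hp ha hα h⟩
  · simp only [expMeasure_eq_map_div (ha _)]
    have := isProbabilityMeasure_expMeasure one_pos
    exact seriesCriteria_of_finite_mean hp ha (fun _ => expMeasure 1)
      (fun _ => ae_pos_expMeasure one_pos) fun _ => lintegral_ofReal_expMeasure_one_ne_top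
  · exact seriesCriteria_of_finite_mean hp ha m hm fun d => (hint d).lintegral_lt_top.ne
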